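/- \textbf{Theorem.} Let $\mathbb F$ be a field, $\mathcal P=\mathbb F[x_1,\dots,x_n]$, $\prec$ an admissible monomial ordering (head monomial $\mathrm{HM}$), and $F=(f_1,\dots,f_m)$ a list of nonzero homogeneous polynomials. Suppose that the module of syzygies $\{\mathbf H\in\mathcal P^m: H_1f_1+\cdots+H_mf_m=0\}$ is generated by the principal syzygies $f_i\mathbf e_j-f_j\mathbf e_i$. Then the algorithm F5C with input $F$ does not reduce any polynomial to zero: in every run, and at every moment of it (whether or not the run terminates), all labeled polynomials stored so far (S-polynomials, their normal forms, and the results of their top-reductions) are nonzero; in particular Top-Reduction never reports a reduction to zero. Here F5C is the following algorithm (choices left open, such as the order in which sets are enumerated, may be made arbitrarily). It keeps a list $r$ of labeled polynomials $r_k=(\mathrm{sig}(k),\mathrm{poly}(k))$ with signatures $\mu\mathbf e_\nu$ ($\mu$ a monomial), ordered by $\nu$ first and then by $\mu$ under $\prec$, and for every $\nu$ a list of rewrite rules $(\mu,j)$. A multiple $u\,\mathrm{poly}(k)$ with $\mathrm{sig}(k)=\mu\mathbf e_\nu$ is \emph{rewritable} if the most recent rule $(\mu',j)$ of index $\nu$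 with $\mu'\mid u\mu$ exists and has $j\ne k$. \emph{Basis.} Sort $F$ by increasing total degree, then by increasing head monomial. Start with $r=((\mathbf e_1,f_1/\mathrm{lc}(f_1)))$, $B=(f_1)$, $G_{prev}=\{1\}$ and no rules. For $i=2,\dots,m$: append $(\mathbf e_{N},f_i/\mathrm{lc}(f_i))$ to $r$, where $N$ is the new length of $r$, with an empty list of rules of index $N$; compute $G$ by Partial-Basis; if some $\mathrm{poly}(k)=1$ with $k\in G$, stop; otherwise let $B=(B_1,\dots,B_s)$ be the interreduction of $\{\mathrm{poly}(k):k\in G\}$ and reset $r=((\mathbf e_j,B_j))_{j\le s}$, $G_{prev}=\{1,\dots,s\}$, with rules of index $k\le s$ given by $(\mathrm{lcm}(\mathrm{HM}(B_j),\mathrm{HM}(B_k))/\mathrm{HM}(B_k),0)$ for $j<k$. \emph{Partial-Basis.} Start with $G=G_{prev}\cup\{N\}$ and the critical pairs of $N$ with the elements of $G_{prev}$. A critical pair $(k,\ell)$ has components $u\,\mathrm{poly}(k)$, $v\,\mathrm{poly}(\ell)$ whose head monomials equal the lcm of the two head monomials; it is discarded if a component has signature $\mu\mathbf e_N$ with $\mu$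 divisible by the head monomial of a polynomial indexed by $G_{prev}$; its components are ordered so that $u\,\mathrm{sig}(k)\succeq v\,\mathrm{sig}(\ell)$. While critical pairs remain, remove those whose lcm has minimal degree; for each, by increasing lcm, unless a component is rewritable, append $(u\,\mathrm{sig}(k),S)$, with $S$ the S-polynomial, to $r$ and add the rule for this signature and this new index. Pass the new indices with $S\neq0$ to Reduction; for each index $k$ it returns, add the critical pairs of $k$ with the elements of $G$, and then add $k$ to $G$. When no pair is left, return $G$. \emph{Reduction.} While indices remain to be done, remove one, $k$, of minimal signature, replace $\mathrm{poly}(k)$ by its normal form modulo $B$, and call Top-Reduction. If $\mathrm{poly}(k)=0$, Top-Reduction reports a reduction to zero, and $k$ is dropped. Otherwise it looks for a reductor: an index $j$ in $G$ or already completed, with $u=\mathrm{HM}(\mathrm{poly}(k))/\mathrm{HM}(\mathrm{poly}(j))$ a monomial, $u\,\mathrm{sig}(j)\ne\mathrm{sig}(k)$, $u\,\mathrm{poly}(j)$ not rewritable, and, for $\mathrm{sig}(j)=\mu\mathbf e_\nu$, $u\mu$ not divisible by the head monomial of a polynomial indexed by $G_{prev}$. If there is none, $\mathrm{poly}(k)$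 is made monic and $k$ is completed. Otherwise let $p$ be the top-reduction of $\mathrm{poly}(k)$ by $\mathrm{poly}(j)$, made monic if nonzero. If $u\,\mathrm{sig}(j)\prec\mathrm{sig}(k)$, replace $\mathrm{poly}(k)$ by $p$ and put $k$ back; if not, append $(u\,\mathrm{sig}(j),p)$ to $r$, add the rule for it, and put both $k$ and the new index back. -/

import Mathlib

open scoped MonomialOrder

/-! ### Syzygies -/

/-- `H` is a syzygy of `F` if `H 0 * F 0 + ... + H (k-1) * F (k-1) = 0`. -/
def IsSyzygy {R : Type*} [CommRing R] {k : ℕ} (F H : Fin k → R) : Prop :=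
  ∑ i, H i * F i = 0

/-- The principal syzygy `f_i e_j - f_j e_i`. -/
def principalSyzygy {R : Type*} [CommRing R] {k : ℕ} (F : Fin k → R) (i j : Fin k) : Fin k → R :=
  F i • Pi.single j (1 : R) - F j • Pi.single i (1 : R)

/-- All syzygies of `F` are generated, as a module, by the principal syzygies. -/
def SyzygiesArePrincipal {R : Type*} [CommRing R] {k : ℕ} (F : Fin k → R) : Prop :=
  ∀ H : Fin k → R, IsSyzygy F H →
    H ∈ Submodule.span R (Set.range fun p : Fin k × Fin k => principalSyzygy F p.1 p.2)

namespace F5C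

/-- Monomials are represented by their exponent vectors: the product is `+`, divisibility is `≤`,
the lcm is `⊔`, and the quotient by a divisor is `-`. -/
abbrev Mon (n : ℕ) := Fin n →₀ ℕ

/-- The signature `μ e_ν`, as the pair `(μ, ν)`. -/
abbrev Sig (n : ℕ) := Mon n × ℕ

/-- The product `u · μ e_ν = (u μ) e_ν` of a monomial and a signature. -/
noncomputable def mulSig {n : ℕ} (u : Mon n) (s : Sig n) : Sig n := (u + s.1, s.2)

/-- The ordering of signatures: the index decides first, then the monomial. -/
def SigLT {n : ℕ} (m : MonomialOrder (Fin n)) (a b : Sig n) : Prop :=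
  a.2 < b.2 ∨ (a.2 = b.2 ∧ a.1 ≺[m] b.1)

/-! ### Reduction, normal forms, interreduction -/

/-- Divide `p` by its head coefficient (`0` stays `0`). -/
noncomputable def makeMonic {n : ℕ} {K : Type*} [Field K] (m : MonomialOrder (Fin n))
    (p : MvPolynomial (Fin n) K) : MvPolynomial (Fin n) K :=
  MvPolynomial.C (m.leadingCoeff p)⁻¹ * p

/-- `p'` arises from `p` by cancelling the term of `p` at the monomial `t` with a multiple
of `q`, whose head monomial divides `t`. -/
def ReducesAt {n : ℕ} {K : Type*} [Field K] (m : MonomialOrder (Fin n))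
    (q : MvPolynomial (Fin n) K) (t : Mon n) (p p' : MvPolynomial (Fin n) K) : Prop :=
  q ≠ 0 ∧ t ∈ p.support ∧ m.degree q ≤ t ∧
    p' = p - MvPolynomial.monomial (t - m.degree q) (p.coeff t * (m.leadingCoeff q)⁻¹) * q

/-- One reduction step of `p` (of an arbitrary term) by some element of the list `B`. -/
def RedStep {n : ℕ} {K : Type*} [Field K] (m : MonomialOrder (Fin n))
    (B : List (MvPolynomial (Fin n) K)) (p p' : MvPolynomial (Fin n) K) : Prop :=
  ∃ q ∈ B, ∃ t, ReducesAt m q t p p'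

/-- No term of `p` is divisible by the head monomial of a nonzero element of `B`. -/
def Irred {n : ℕ} {K : Type*} [Field K] (m : MonomialOrder (Fin n))
    (B : List (MvPolynomial (Fin n) K)) (p : MvPolynomial (Fin n) K) : Prop :=
  ∀ q ∈ B, q ≠ 0 → ∀ t ∈ p.support, ¬ m.degree q ≤ t

/-- `h` is a normal form of `p` modulo `B`: a result of complete reduction of `p` by `B`. -/
def IsNormalForm {n : ℕ} {K : Type*} [Field K] (m : MonomialOrder (Fin n))
    (B : List (MvPolynomial (Fin n) K)) (p h : MvPolynomial (Fin n) K) : Prop :=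
  Relation.ReflTransGen (RedStep m B) p h ∧ Irred m B h

/-- One step of interreduction of a list of polynomials. -/
inductive InterredStep {n : ℕ} {K : Type*} [Field K] (m : MonomialOrder (Fin n)) :
    List (MvPolynomial (Fin n) K) → List (MvPolynomial (Fin n) K) → Prop
  /-- reduce an element by the other ones -/
  | reduce (p p' : MvPolynomial (Fin n) K) (L : List (MvPolynomial (Fin n) K))
      (h : RedStep m L p p') : InterredStep m (p :: L) (p' :: L)
  /-- drop a zero -/
  | drop (L : List (MvPolynomial (Fin n) K)) : InterredStep m (0 :: L) L
  /-- make an element monic -/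
  | scale (p : MvPolynomial (Fin n) K) (L : List (MvPolynomial (Fin n) K)) :
      InterredStep m (p :: L) (makeMonic m p :: L)
  /-- list the elements in another order -/
  | perm (L L' : List (MvPolynomial (Fin n) K)) (h : L.Perm L') : InterredStep m L L'

/-- `B` consists of monic polynomials, none of which is reducible by the others. -/
def IsInterreduced {n : ℕ} {K : Type*} [Field K] (m : MonomialOrder (Fin n))
    (B : List (MvPolynomial (Fin n) K)) : Prop :=
  (∀ b ∈ B, m.leadingCoeff b = 1) ∧
    ∀ (L : List (MvPolynomial (Fin n) K)) (b : MvPolynomial (Fin n) K),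
      B.Perm (b :: L) → Irred m L b

/-- `B` is a result of interreducing `P`. -/
def IsInterreduction {n : ℕ} {K : Type*} [Field K] (m : MonomialOrder (Fin n))
    (P B : List (MvPolynomial (Fin n) K)) : Prop :=
  Relation.ReflTransGen (InterredStep m) P B ∧ IsInterreduced m B

/-! ### The state of the algorithm -/

/-- A critical pair `(t, k, u, ℓ, v)`: the lcm `t` of the head monomials, the index `k` of the
generator with the larger signature and its multiplier `u`, the other index `ℓ` and its
multiplier `v`. -/
structure CPair (n : ℕ) where
  t : Mon n
  k : ℕ
  u : Mon n
  l : ℕ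
  v : Mon n

/-- The position reached in the program, together with the local variables used there. -/
inductive Ctrl (n : ℕ)
  /-- head of the loop of `Basis` -/
  | main
  /-- head of the loop of `Partial_Basis` -/
  | partialBasis
  /-- in `SPols`, with the list of pairs still to be considered, and the list of new indices -/
  | spols (todo : List (CPair n)) (new : Finset ℕ)
  /-- head of the loop of `Reduction` -/
  | reduction (todo completed : Finset ℕ)
  /-- call of `Top_Reduction` for the index `k` -/
  | topReduction (k : ℕ) (todo completed : Finset ℕ)
  /-- in `Partial_Basis`, after `Reduction`: the indices for which new critical pairs still
  have to be generated -/
  | collect (reduced : Finset ℕ)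
  /-- the algorithm has returned -/
  | done

/-- A state of the algorithm.

* `num` is the length of the list `r` of labeled polynomials, `r_k = (sig k, poly k)` for
  `1 ≤ k ≤ num`; the index `0` is that of the phantom polynomial.
* `rules ν` is the list of rewrite rules for the signature index `ν`, oldest first.
* `B` is the previous basis as a list of polynomials, `prev` the set of its indices in `r`.
* `curr` is the set of indices of the current generators.
* `idx` is the signature index of the generator that is currently added.
* `pairs` is the set of critical pairs which still have to be considered.
* `rest` is the list of input polynomials which still have to be added.
* `zeroReductions` counts how often `Top_Reduction` has reported a reduction to zero. -/
structure State (n : ℕ) (K : Type*) [Field K] where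
  num : ℕ
  sig : ℕ → Sig n
  poly : ℕ → MvPolynomial (Fin n) K
  rules : ℕ → List (Mon n × ℕ)
  B : List (MvPolynomial (Fin n) K)
  prev : Finset ℕ
  curr : Finset ℕ
  idx : ℕ
  pairs : Set (CPair n)
  rest : List (MvPolynomial (Fin n) K)
  zeroReductions : ℕ
  ctrl : Ctrl n

namespace State

/-- Append the labeled polynomial `(s, p)` to `r`. -/
def append {n : ℕ} {K : Type*} [Field K] (S : State n K) (s : Sig n)
    (p : MvPolynomial (Fin n) K) : State n K :=
  { S with
    num := S.num + 1
    sig := Function.update S.sig (S.num + 1) s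
    poly := Function.update S.poly (S.num + 1) p }

/-- `Add_Rule`: append `(μ, k)` to the list of rules with the index of the signature `s = μ e_ν`. -/
def addRule {n : ℕ} {K : Type*} [Field K] (S : State n K) (s : Sig n) (k : ℕ) : State n K :=
  { S with rules := Function.update S.rules s.2 (S.rules s.2 ++ [(s.1, k)]) }

/-- Replace the polynomial of `r_k` by `p`, keeping the signature. -/
def setPoly {n : ℕ} {K : Type*} [Field K] (S : State n K) (k : ℕ)
    (p : MvPolynomial (Fin n) K) : State n K :=
  { S with poly := Function.update S.poly k p }

/-- Continue at the position `c` of the program. -/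
def goto {n : ℕ} {K : Type*} [Field K] (S : State n K) (c : Ctrl n) : State n K :=
  { S with ctrl := c }

/-- `Find_Rewriting`: the index of the most recent rule of the same index as `sig k` whose
monomial divides that of `u · sig k`; `k` itself if there is none. -/
noncomputable def findRewriting {n : ℕ} {K : Type*} [Field K] (S : State n K) (u : Mon n) (k : ℕ) : ℕ :=
  match (S.rules (S.sig k).2).reverse.find? (fun ρ => decide (ρ.1 ≤ u + (S.sig k).1)) with
  | some ρ => ρ.2
  | none => k

/-- `Is_Rewritable`. -/
def Rewritable {n : ℕ} {K : Type*} [Field K] (S : State n K) (u : Mon n) (k : ℕ) : Prop :=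
  S.findRewriting u k ≠ k

/-- The monomial `w` is top-reducible by the polynomials indexed by `prev`. -/
def TopRedByPrev {n : ℕ} {K : Type*} [Field K] (m : MonomialOrder (Fin n)) (S : State n K)
    (w : Mon n) : Prop :=
  ∃ j ∈ S.prev, m.degree (S.poly j) ≤ w

/-- The multiplier `lcm(lt(poly k), lt(poly l)) / lt(poly k)`. -/
noncomputable def mult {n : ℕ} {K : Type*} [Field K] (m : MonomialOrder (Fin n)) (S : State n K)
    (k l : ℕ) : Mon n :=
  (m.degree (S.poly k) ⊔ m.degree (S.poly l)) - m.degree (S.poly k)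

/-- A component `u · poly k` is rejected by `Critical_Pair`: its signature has the current index
and a monomial that is top-reducible by the previous basis. -/
def Rejected {n : ℕ} {K : Type*} [Field K] (m : MonomialOrder (Fin n)) (S : State n K)
    (u : Mon n) (k : ℕ) : Prop :=
  (S.sig k).2 = S.idx ∧ S.TopRedByPrev m (u + (S.sig k).1)

/-- `Critical_Pair`: the set, with at most one element, of critical pairs returned for the
indices `k` and `l`. -/
def critPair {n : ℕ} {K : Type*} [Field K] (m : MonomialOrder (Fin n)) (S : State n K)
    (k l : ℕ) : Set (CPair n) :=
  { c | ¬ S.Rejected m (S.mult m k l) k ∧ ¬ S.Rejected m (S.mult m l k) l ∧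
      ((SigLT m (mulSig (S.mult m k l) (S.sig k)) (mulSig (S.mult m l k) (S.sig l)) ∧
          c = ⟨m.degree (S.poly k) ⊔ m.degree (S.poly l), l, S.mult m l k, k, S.mult m k l⟩) ∨
        (¬ SigLT m (mulSig (S.mult m k l) (S.sig k)) (mulSig (S.mult m l k) (S.sig l)) ∧
          c = ⟨m.degree (S.poly k) ⊔ m.degree (S.poly l), k, S.mult m k l, l, S.mult m l k⟩)) }

/-- `j` is an admissible output of `Find_Reductor` for the index `k` and the generators indexed
by `G`. -/
def IsReductor {n : ℕ} {K : Type*} [Field K] (m : MonomialOrder (Fin n)) (S : State n K)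
    (G : Finset ℕ) (k j : ℕ) : Prop :=
  j ∈ G ∧ m.degree (S.poly j) ≤ m.degree (S.poly k) ∧
    mulSig (m.degree (S.poly k) - m.degree (S.poly j)) (S.sig j) ≠ S.sig k ∧
    ¬ S.Rewritable (m.degree (S.poly k) - m.degree (S.poly j)) j ∧
    ¬ S.TopRedByPrev m ((m.degree (S.poly k) - m.degree (S.poly j)) + (S.sig j).1)

/-- The monic multiple of the polynomial obtained from `poly k` by one top-reduction by
`poly j`. -/
noncomputable def topReduce {n : ℕ} {K : Type*} [Field K] (m : MonomialOrder (Fin n))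
    (S : State n K) (k j : ℕ) : MvPolynomial (Fin n) K :=
  makeMonic m (S.poly k - MvPolynomial.monomial (m.degree (S.poly k) - m.degree (S.poly j))
    (m.leadingCoeff (S.poly k) * (m.leadingCoeff (S.poly j))⁻¹) * S.poly j)

/-- The first lines of the loop of `Basis` and of `Partial_Basis`: append the next input
polynomial `f` to `r` with a new signature `e_i`, where `i` is the new length of `r`, and an empty
list to the rules. -/
noncomputable def enter {n : ℕ} {K : Type*} [Field K] (m : MonomialOrder (Fin n)) (S : State n K)
    (f : MvPolynomial (Fin n) K) (rest : List (MvPolynomial (Fin n) K)) : State n K :=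
  { S.append (0, S.num + 1) (makeMonic m f) with
    rules := Function.update S.rules (S.num + 1) []
    curr := insert (S.num + 1) S.prev
    idx := S.num + 1
    rest := rest
    ctrl := Ctrl.partialBasis }

/-- The new contents of `r`, the rules and `prev` after `Setup_Reduced_Basis` has found the
interreduction `B = (B_1, B_2, ...)`: `r_j = (e_j, B_j)`, and the rules of index `k` are
`(lcm(lt(B_j), lt(B_k)) / lt(B_k), 0)` for `j = 1, ..., k - 1`. -/
noncomputable def setup {n : ℕ} {K : Type*} [Field K] (m : MonomialOrder (Fin n)) (S : State n K)
    (B : List (MvPolynomial (Fin n) K)) : State n K :=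
  { S with
    num := B.length
    sig := fun j => (0, j)
    poly := fun j => if 1 ≤ j then B.getD (j - 1) 0 else 0
    rules := fun k =>
      if 1 ≤ k ∧ k ≤ B.length then
        (B.take (k - 1)).map fun b =>
          ((m.degree b ⊔ m.degree (B.getD (k - 1) 0)) - m.degree (B.getD (k - 1) 0), 0)
      else []
    B := B
    prev := Finset.Icc 1 B.length
    curr := Finset.Icc 1 B.length
    ctrl := Ctrl.main }

end State

/-! ### The algorithm -/

/-- One step of F5C. The pseudocode leaves some choices open (the order in which sets are
enumerated, and how ties are broken); every choice is admitted. -/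
inductive Step {n : ℕ} {K : Type*} [Field K] (m : MonomialOrder (Fin n)) :
    State n K → State n K → Prop
  /-- `Basis`: no input polynomial is left; return. -/
  | finish (S : State n K) (hc : S.ctrl = Ctrl.main) (hr : S.rest = []) :
      Step m S (S.goto Ctrl.done)
  /-- `Basis` appends the next input polynomial and calls `Partial_Basis`, which forms the
  critical pairs of the new index with the indices of the previous basis. -/
  | enter (S : State n K) (f : MvPolynomial (Fin n) K) (rest : List (MvPolynomial (Fin n) K))
      (hc : S.ctrl = Ctrl.main) (hr : S.rest = f :: rest) :
      Step m S { S.enter m f rest with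
        pairs := ⋃ j ∈ S.prev, (S.enter m f rest).critPair m (S.num + 1) j }
  /-- `Partial_Basis` selects the critical pairs of minimal degree `d` and calls `SPols`, which
  goes through them from the smallest to the largest lcm. -/
  | select (S : State n K) (d : ℕ) (L : List (CPair n)) (hc : S.ctrl = Ctrl.partialBasis)
      (hd : IsLeast ((fun c : CPair n => c.t.degree) '' S.pairs) d)
      (hL : ∀ c, c ∈ L ↔ c ∈ S.pairs ∧ c.t.degree = d) (hnd : L.Nodup)
      (hs : L.Pairwise fun c c' => c.t ≼[m] c'.t) :
      Step m S { S with
        pairs := { c ∈ S.pairs | c.t.degree ≠ d }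
        ctrl := Ctrl.spols L ∅ }
  /-- `SPols` discards a pair with a rewritable component. -/
  | spolSkip (S : State n K) (c : CPair n) (L : List (CPair n)) (new : Finset ℕ)
      (hc : S.ctrl = Ctrl.spols (c :: L) new)
      (hw : S.Rewritable c.u c.k ∨ S.Rewritable c.v c.l) :
      Step m S (S.goto (Ctrl.spols L new))
  /-- `SPols` computes a nonzero S-polynomial. -/
  | spolTake (S : State n K) (c : CPair n) (L : List (CPair n)) (new : Finset ℕ)
      (hc : S.ctrl = Ctrl.spols (c :: L) new)
      (hk : ¬ S.Rewritable c.u c.k) (hl : ¬ S.Rewritable c.v c.l)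
      (h0 : m.sPolynomial (S.poly c.k) (S.poly c.l) ≠ 0) :
      Step m S
        (((S.append (mulSig c.u (S.sig c.k)) (m.sPolynomial (S.poly c.k) (S.poly c.l))).addRule
          (mulSig c.u (S.sig c.k)) (S.num + 1)).goto (Ctrl.spols L (insert (S.num + 1) new)))
  /-- `SPols` computes an S-polynomial that is zero: it is recorded, but not passed on. -/
  | spolZero (S : State n K) (c : CPair n) (L : List (CPair n)) (new : Finset ℕ)
      (hc : S.ctrl = Ctrl.spols (c :: L) new)
      (hk : ¬ S.Rewritable c.u c.k) (hl : ¬ S.Rewritable c.v c.l)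
      (h0 : m.sPolynomial (S.poly c.k) (S.poly c.l) = 0) :
      Step m S
        (((S.append (mulSig c.u (S.sig c.k)) (m.sPolynomial (S.poly c.k) (S.poly c.l))).addRule
          (mulSig c.u (S.sig c.k)) (S.num + 1)).goto (Ctrl.spols L new))
  /-- `SPols` returns, and `Partial_Basis` calls `Reduction`. -/
  | spolsEnd (S : State n K) (new : Finset ℕ) (hc : S.ctrl = Ctrl.spols [] new) :
      Step m S (S.goto (Ctrl.reduction new ∅))
  /-- `Reduction` takes an index `k` with minimal signature, replaces its polynomial by its
  normal form modulo the previous basis, and calls `Top_Reduction`. -/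
  | normalForm (S : State n K) (todo completed : Finset ℕ) (k : ℕ)
      (h : MvPolynomial (Fin n) K) (hc : S.ctrl = Ctrl.reduction todo completed)
      (hk : k ∈ todo) (hmin : ∀ j ∈ todo, ¬ SigLT m (S.sig j) (S.sig k))
      (hh : IsNormalForm m S.B (S.poly k) h) :
      Step m S ((S.setPoly k h).goto (Ctrl.topReduction k (todo.erase k) completed))
  /-- `Top_Reduction` reports a reduction to zero. -/
  | zero (S : State n K) (todo completed : Finset ℕ) (k : ℕ)
      (hc : S.ctrl = Ctrl.topReduction k todo completed) (h0 : S.poly k = 0) :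
      Step m S { S with
        zeroReductions := S.zeroReductions + 1
        ctrl := Ctrl.reduction todo completed }
  /-- `Find_Reductor` finds nothing: the polynomial is made monic and completed. -/
  | complete (S : State n K) (todo completed : Finset ℕ) (k : ℕ)
      (hc : S.ctrl = Ctrl.topReduction k todo completed) (h0 : S.poly k ≠ 0)
      (hJ : ∀ j, ¬ S.IsReductor m (S.curr ∪ completed) k j) :
      Step m S ((S.setPoly k (makeMonic m (S.poly k))).goto
        (Ctrl.reduction todo (insert k completed)))
  /-- A top-reduction that preserves the signature. -/
  | preserve (S : State n K) (todo completed : Finset ℕ) (k j : ℕ)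
      (hc : S.ctrl = Ctrl.topReduction k todo completed) (h0 : S.poly k ≠ 0)
      (hJ : S.IsReductor m (S.curr ∪ completed) k j)
      (hs : SigLT m (mulSig (m.degree (S.poly k) - m.degree (S.poly j)) (S.sig j)) (S.sig k)) :
      Step m S ((S.setPoly k (S.topReduce m k j)).goto
        (Ctrl.reduction (insert k todo) completed))
  /-- A top-reduction that would increase the signature: its result is appended to `r` as a new
  labeled polynomial with the larger signature. -/
  | newLabel (S : State n K) (todo completed : Finset ℕ) (k j : ℕ)
      (hc : S.ctrl = Ctrl.topReduction k todo completed) (h0 : S.poly k ≠ 0)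
      (hJ : S.IsReductor m (S.curr ∪ completed) k j)
      (hs : ¬ SigLT m (mulSig (m.degree (S.poly k) - m.degree (S.poly j)) (S.sig j)) (S.sig k)) :
      Step m S
        (((S.append (mulSig (m.degree (S.poly k) - m.degree (S.poly j)) (S.sig j))
            (S.topReduce m k j)).addRule
          (mulSig (m.degree (S.poly k) - m.degree (S.poly j)) (S.sig j)) (S.num + 1)).goto
          (Ctrl.reduction (insert k (insert (S.num + 1) todo)) completed))
  /-- `Reduction` returns. -/
  | reductionEnd (S : State n K) (completed : Finset ℕ)
      (hc : S.ctrl = Ctrl.reduction ∅ completed) :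
      Step m S (S.goto (Ctrl.collect completed))
  /-- `Partial_Basis` generates the critical pairs of a reduced polynomial with all current
  generators, and adds its index to them. -/
  | collect (S : State n K) (reduced : Finset ℕ) (k : ℕ)
      (hc : S.ctrl = Ctrl.collect reduced) (hk : k ∈ reduced) :
      Step m S { S with
        pairs := S.pairs ∪ ⋃ j ∈ S.curr, S.critPair m k j
        curr := insert k S.curr
        ctrl := Ctrl.collect (reduced.erase k) }
  /-- All reduced polynomials have been treated. -/
  | collectEnd (S : State n K) (hc : S.ctrl = Ctrl.collect ∅) :
      Step m S (S.goto Ctrl.partialBasis)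
  /-- `Partial_Basis` returns, and `1` has been found: `Basis` returns. -/
  | one (S : State n K) (hc : S.ctrl = Ctrl.partialBasis) (hp : S.pairs = ∅)
      (h1 : ∃ k ∈ S.curr, S.poly k = 1) : Step m S (S.goto Ctrl.done)
  /-- `Partial_Basis` returns, and `Basis` calls `Setup_Reduced_Basis`, which interreduces the
  set `{poly k : k ∈ curr}`. -/
  | setup (S : State n K) (P B : List (MvPolynomial (Fin n) K))
      (hc : S.ctrl = Ctrl.partialBasis) (hp : S.pairs = ∅) (h1 : ¬ ∃ k ∈ S.curr, S.poly k = 1)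
      (hP : ∀ p, p ∈ P ↔ ∃ k ∈ S.curr, S.poly k = p) (hnd : P.Nodup)
      (hB : IsInterreduction m P B) : Step m S (S.setup m B)

/-- The list is sorted by increasing total degree, ties being broken by increasing head
monomial. -/
def IsSorted {n : ℕ} {K : Type*} [Field K] (m : MonomialOrder (Fin n))
    (L : List (MvPolynomial (Fin n) K)) : Prop :=
  L.Pairwise fun f g => f.totalDegree < g.totalDegree ∨
    (f.totalDegree = g.totalDegree ∧ m.degree f ≼[m] m.degree g)

/-- The state at the first arrival at the loop of `Basis`, when the sorted input is
`f :: rest`. -/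
noncomputable def initState {n : ℕ} {K : Type*} [Field K] (m : MonomialOrder (Fin n))
    (f : MvPolynomial (Fin n) K) (rest : List (MvPolynomial (Fin n) K)) : State n K where
  num := 1
  sig := fun j => (0, j)
  poly := fun j => if j = 1 then makeMonic m f else 0
  rules := fun _ => []
  B := [f]
  prev := {1}
  curr := {1}
  idx := 1
  pairs := ∅
  rest := rest
  zeroReductions := 0
  ctrl := Ctrl.main

/-- `S` is a state that F5C can reach when it is started with the input `F`. -/
def Reaches {n : ℕ} {K : Type*} [Field K] (m : MonomialOrder (Fin n)) {k : ℕ}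
    (F : Fin k → MvPolynomial (Fin n) K) (S : State n K) : Prop :=
  ∃ f rest, (f :: rest).Perm (List.ofFn F) ∧ IsSorted m (f :: rest) ∧
    Relation.ReflTransGen (Step m) (initState m f rest) S

end F5C

/-! Fix one iteration: I is the ideal of the inputs already treated, f the input being added. Each
labeled polynomial p of the current index satisfies p ≡ h f modulo I, where the head monomial of h
is the monomial of the signature (`Lab`). Except for the new generator itself, that monomial lies
outside the head ideal of I (not `InLead`). If p were in I, then h f would be in I, hence h too once
f is a nonzerodivisor modulo I, and the head monomial of h would contradict this (`Lab.notMem`). So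
p is never zero. Three things must be supplied.

(1) f is a nonzerodivisor modulo I. For homogeneous polynomials of positive degree, the property
that all syzygies are principal passes to subfamilies by induction on the degree
(`PrincipalOn.of_insert`), and then the k-th coordinate of a syzygy lies in the ideal of the other
elements (`PrincipalOn.mem_span_of_mul_mem`). Constants are sorted to the front and make the later
cases trivial.

(2) The labels stay true. A difference keeps the larger label only if the two labels differ. For
S-polynomials a tie is excluded by the rewrite rules (`IterInv.lab_sPolynomial`), for top-reductions
by the choice of the reductor. Normal forms modulo the previous basis change p only inside I.

(3) The algorithm tests divisibility only by head monomials of the previous basis, so this basis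
must be a Gröbner basis of I; that is, every iteration that ends must have been correct, although it
discards pairs. For a monomial σ take the last k whose signature divides σ. By induction on σ, the
corresponding multiple of `poly k` has the least head monomial among all polynomials with label σ
(`lastDivisorMinimal`). A counterexample leads to a critical pair of two last divisors, or of one
with the previous basis, and every such pair was treated or forbidden by a rule
(`IterInv.groebner`).

All this is packed into an invariant of single transitions (`Inv.step`), so termination plays no
role. -/

namespace F5C

/-! ### Cofactors modulo an ideal and their head monomials -/

section Labels

variable {n : ℕ} {K : Type*} [Field K] (m : MonomialOrder (Fin n))

/-- The monomial `σ` is divisible by the head monomial of a nonzero element of `I`. -/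
def InLead (I : Ideal (MvPolynomial (Fin n) K)) (σ : Mon n) : Prop :=
  ∃ g ∈ I, g ≠ 0 ∧ m.degree g ≤ σ

/-- `σ` is the head monomial of a cofactor `h` with `p ≡ h * f` modulo `I`. -/
def Lab (I : Ideal (MvPolynomial (Fin n) K)) (f : MvPolynomial (Fin n) K) (σ : Mon n)
    (p : MvPolynomial (Fin n) K) : Prop :=
  ∃ h, h ≠ 0 ∧ m.degree h = σ ∧ p - h * f ∈ I

variable {m} {I : Ideal (MvPolynomial (Fin n) K)} {f : MvPolynomial (Fin n) K}

theorem InLead.mono {σ τ : Mon n} (h : InLead m I σ) (hst : σ ≤ τ) : InLead m I τ := by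
  obtain ⟨g, hg, hg0, hd⟩ := h
  exact ⟨g, hg, hg0, hd.trans hst⟩

theorem degree_monomial_mul {u : Mon n} {c : K} (hc : c ≠ 0) {p : MvPolynomial (Fin n) K}
    (hp : p ≠ 0) : m.degree (MvPolynomial.monomial u c * p) = u + m.degree p := by
  classical
  rw [m.degree_mul (by simpa using hc) hp, m.degree_monomial, if_neg hc]

theorem sub_ne_zero_of_degree_lt {p q : MvPolynomial (Fin n) K} (h : m.degree q ≺[m] m.degree p) :
    p - q ≠ 0 := by
  intro h0
  rw [sub_eq_zero.mp h0] at h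
  exact lt_irrefl _ h

/-- Cancelling the head terms of two polynomials with the same degree. -/
theorem exists_sub_degree_lt {p q : MvPolynomial (Fin n) K} (hp : p ≠ 0) (hq : q ≠ 0)
    (h : m.degree p = m.degree q) :
    ∃ c : K, c ≠ 0 ∧ (p - MvPolynomial.C c * q = 0 ∨
      m.degree (p - MvPolynomial.C c * q) ≺[m] m.degree p) := by
  have hlp := m.leadingCoeff_ne_zero_iff.mpr hp
  have hlq := m.leadingCoeff_ne_zero_iff.mpr hq
  refine ⟨m.leadingCoeff p / m.leadingCoeff q, div_ne_zero hlp hlq, ?_⟩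
  set r := p - MvPolynomial.C (m.leadingCoeff p / m.leadingCoeff q) * q with hr
  by_cases h0 : r = 0
  · exact Or.inl h0
  right
  have hle : m.degree r ≼[m] m.degree p := by
    rw [m.degree_le_iff]
    intro c hc
    rw [MvPolynomial.mem_support_iff, hr, MvPolynomial.coeff_sub, MvPolynomial.coeff_C_mul] at hc
    by_contra hlt
    rw [not_le] at hlt
    rw [m.coeff_eq_zero_of_lt hlt, m.coeff_eq_zero_of_lt (h ▸ hlt)] at hc
    simp at hc
  refine lt_of_le_of_ne hle fun he => ?_
  have he' := m.toSyn.injective he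
  have hq' : q.coeff (m.degree p) = m.leadingCoeff q := by rw [h, MonomialOrder.leadingCoeff]
  have : r.coeff (m.degree r) = 0 := by
    rw [he', hr, MvPolynomial.coeff_sub, MvPolynomial.coeff_C_mul, hq', div_mul_cancel₀ _ hlq]
    exact sub_self _
  exact m.coeff_degree_ne_zero_iff.mpr h0 this

/-- The same cofactor serves, which is why reduction modulo the previous basis does not disturb
signatures. -/
theorem Lab.congr {σ : Mon n} {p q : MvPolynomial (Fin n) K} (h : Lab m I f σ p)
    (hpq : q - p ∈ I) : Lab m I f σ q := by
  obtain ⟨a, ha, hd, hm⟩ := h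
  exact ⟨a, ha, hd, by simpa using I.add_mem hpq hm⟩

theorem Lab.monomial_mul {σ : Mon n} {p : MvPolynomial (Fin n) K} (h : Lab m I f σ p)
    (u : Mon n) {c : K} (hc : c ≠ 0) :
    Lab m I f (u + σ) (MvPolynomial.monomial u c * p) := by
  obtain ⟨a, ha, hd, hm⟩ := h
  refine ⟨MvPolynomial.monomial u c * a, mul_ne_zero (by simpa using hc) ha, ?_, ?_⟩
  · rw [degree_monomial_mul hc ha, hd]
  · rw [mul_assoc, ← mul_sub]
    exact I.mul_mem_left _ hm

theorem Lab.C_mul {σ : Mon n} {p : MvPolynomial (Fin n) K} (h : Lab m I f σ p)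
    {c : K} (hc : c ≠ 0) : Lab m I f σ (MvPolynomial.C c * p) := by
  simpa using h.monomial_mul 0 hc

/-- Strictness keeps the head term of the larger cofactor from cancelling; with equal labels the
label could be lost. -/
theorem Lab.sub {σ τ : Mon n} {p q : MvPolynomial (Fin n) K} (hp : Lab m I f σ p)
    (hq : Lab m I f τ q) (hlt : τ ≺[m] σ) : Lab m I f σ (p - q) := by
  obtain ⟨a, ha, rfl, hm⟩ := hp
  obtain ⟨b, hb, rfl, hm'⟩ := hq
  refine ⟨a - b, sub_ne_zero_of_degree_lt hlt, m.degree_sub_of_lt hlt, ?_⟩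
  have := I.sub_mem hm hm'
  convert this using 1
  ring

theorem Lab.sub' {σ τ : Mon n} {p q : MvPolynomial (Fin n) K} (hp : Lab m I f σ p)
    (hq : Lab m I f τ q) (hlt : σ ≺[m] τ) : Lab m I f τ (p - q) := by
  have := (hq.sub hp hlt).C_mul (c := -1) (by simp)
  simpa using this

/-- If p were in I, so would be the cofactor times f, hence the cofactor itself, whose head monomial
is σ. This is the only reason why no reduction to zero occurs. -/
theorem Lab.notMem (hnzd : ∀ h, h * f ∈ I → h ∈ I) {σ : Mon n} {p : MvPolynomial (Fin n) K}
    (hp : Lab m I f σ p) (hσ : ¬ InLead m I σ) : p ∉ I := by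
  obtain ⟨a, ha, rfl, hm⟩ := hp
  intro hpI
  have : a * f ∈ I := by simpa using I.sub_mem hpI hm
  exact hσ ⟨a, hnzd a this, ha, le_rfl⟩

theorem Lab.ne_zero (hnzd : ∀ h, h * f ∈ I → h ∈ I) {σ : Mon n} {p : MvPolynomial (Fin n) K}
    (hp : Lab m I f σ p) (hσ : ¬ InLead m I σ) : p ≠ 0 := by
  rintro rfl
  exact hp.notMem hnzd hσ I.zero_mem

theorem Lab.leadingCoeff_ne_zero (hnzd : ∀ h, h * f ∈ I → h ∈ I) {σ : Mon n}
    {p : MvPolynomial (Fin n) K} (hp : Lab m I f σ p) (hσ : ¬ InLead m I σ) :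
    m.leadingCoeff p ≠ 0 :=
  m.leadingCoeff_ne_zero_iff.mpr (hp.ne_zero hnzd hσ)

theorem Lab.makeMonic (hnzd : ∀ h, h * f ∈ I → h ∈ I) {σ : Mon n} {p : MvPolynomial (Fin n) K}
    (hp : Lab m I f σ p) (hσ : ¬ InLead m I σ) : Lab m I f σ (makeMonic m p) :=
  hp.C_mul (inv_ne_zero (hp.leadingCoeff_ne_zero hnzd hσ))

/-- The cofactor can be reduced modulo `I` until its head monomial is not in that of `I`. -/
theorem mem_or_exists_lab {p h : MvPolynomial (Fin n) K} (hp : p - h * f ∈ I) :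
    p ∈ I ∨ ∃ τ, τ ≼[m] m.degree h ∧ ¬ InLead m I τ ∧ Lab m I f τ p := by
  induction hs : m.toSyn (m.degree h) using WellFoundedLT.induction generalizing h with
  | ind s ih =>
    subst hs
    by_cases h0 : h = 0
    · left
      simpa [h0] using hp
    by_cases hl : InLead m I (m.degree h)
    · obtain ⟨g, hg, hg0, hd⟩ := hl
      -- Subtracting a multiple of an element of I from the cofactor lowers its head monomial and
      -- changes the product with f only inside I.
      set g' := MvPolynomial.monomial (m.degree h - m.degree g) (1 : K) * g with hg'
      have hdg : m.degree h = m.degree g' := by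
        rw [hg', degree_monomial_mul one_ne_zero hg0, tsub_add_cancel_of_le hd]
      obtain ⟨c, hc, hlt⟩ := exists_sub_degree_lt h0
        (q := g') (mul_ne_zero (by simp) hg0) hdg
      have hg'I : MvPolynomial.C c * g' * f ∈ I :=
        I.mul_mem_right _ (I.mul_mem_left _ (I.mul_mem_left _ hg))
      have hp' : p - (h - MvPolynomial.C c * g') * f ∈ I := by
        convert I.add_mem hp hg'I using 1
        ring
      rcases hlt with hlt | hlt
      · left
        simpa [hlt] using hp'
      · rcases ih _ hlt hp' rfl with h1 | ⟨τ, h1, h2⟩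
        · exact Or.inl h1
        · exact Or.inr ⟨τ, h1.trans hlt.le, h2⟩
    · exact Or.inr ⟨_, le_rfl, hl, h, h0, rfl, hp⟩

/-- Two polynomials with the same label have a combination with a smaller label. -/
theorem Lab.exists_sub {σ : Mon n} {p q : MvPolynomial (Fin n) K} (hp : Lab m I f σ p)
    (hq : Lab m I f σ q) : ∃ c : K, c ≠ 0 ∧ (p - MvPolynomial.C c * q ∈ I ∨
      ∃ τ, τ ≺[m] σ ∧ ¬ InLead m I τ ∧ Lab m I f τ (p - MvPolynomial.C c * q)) := by
  obtain ⟨a, ha, rfl, hm⟩ := hp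
  obtain ⟨b, hb, hd, hm'⟩ := hq
  -- The constant is chosen to cancel the head terms of the cofactors, not those of p and q.
  obtain ⟨c, hc, hlt⟩ := exists_sub_degree_lt ha hb hd.symm
  refine ⟨c, hc, ?_⟩
  have hI : p - MvPolynomial.C c * q - (a - MvPolynomial.C c * b) * f ∈ I := by
    convert I.sub_mem hm (I.mul_mem_left (MvPolynomial.C c) hm') using 1
    ring
  rcases hlt with hlt | hlt
  · left
    simpa [hlt] using hI
  · rcases mem_or_exists_lab (m := m) hI with h | ⟨τ, h1, h2⟩
    · exact Or.inl h
    · exact Or.inr ⟨τ, h1.trans_lt hlt, h2⟩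

theorem degree_sub_C_mul {p q : MvPolynomial (Fin n) K} (c : K)
    (h : m.degree q ≺[m] m.degree p) : m.degree (p - MvPolynomial.C c * q) = m.degree p ∧
      p - MvPolynomial.C c * q ≠ 0 := by
  have hlt : m.degree (MvPolynomial.C c * q) ≺[m] m.degree p := by
    rw [← MvPolynomial.smul_eq_C_mul]
    exact m.degree_smul_le.trans_lt h
  exact ⟨m.degree_sub_of_lt hlt, sub_ne_zero_of_degree_lt hlt⟩

end Labels

/-! ### The rewrite criterion: last divisors of a signature -/

section Rewriters

variable {n : ℕ} {K : Type*} [Field K] {m : MonomialOrder (Fin n)}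
  {I : Ideal (MvPolynomial (Fin n) K)} {f : MvPolynomial (Fin n) K}

/-- `k` is the largest element of `T` such that `μ k` divides `σ`. -/
def IsLastDivisor (T : Finset ℕ) (μ : ℕ → Mon n) (σ : Mon n) (k : ℕ) : Prop :=
  k ∈ T ∧ μ k ≤ σ ∧ ∀ j ∈ T, k < j → ¬ μ j ≤ σ

theorem exists_isLastDivisor {T : Finset ℕ} {μ : ℕ → Mon n} {σ : Mon n}
    (h : ∃ k ∈ T, μ k ≤ σ) : ∃ k, IsLastDivisor T μ σ k := by
  classical
  obtain ⟨k, hk, hks⟩ := h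
  obtain ⟨j, hj, hmax⟩ := (T.filter fun k => μ k ≤ σ).exists_max_image id
    ⟨k, Finset.mem_filter.mpr ⟨hk, hks⟩⟩
  rw [Finset.mem_filter] at hj
  refine ⟨j, hj.1, hj.2, fun i hi hji his => ?_⟩
  exact absurd (hmax i (Finset.mem_filter.mpr ⟨hi, his⟩)) (not_le.mpr hji)

/-- The multiple of label `σ` of its last divisor has the least possible head monomial. -/
def LastDivisorMinimal (m : MonomialOrder (Fin n)) (I : Ideal (MvPolynomial (Fin n) K))
    (f : MvPolynomial (Fin n) K) (T : Finset ℕ) (μ : ℕ → Mon n)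
    (poly : ℕ → MvPolynomial (Fin n) K) (σ : Mon n) : Prop :=
  ∀ k, IsLastDivisor T μ σ k → ∀ q, Lab m I f σ q →
    σ - μ k + m.degree (poly k) ≼[m] m.degree q

/-- Descent on the label: minimality bounds the head monomial of the last divisor's multiple by that
of p. If they agree, the search is over; if not, subtracting the multiple keeps the head monomial of
p and lowers the label. Minimality is assumed only up to τ, so that this can be used inside an
induction proving minimality. -/
theorem inLead_or_exists_isLastDivisor {T : Finset ℕ} {μ : ℕ → Mon n}
    {poly : ℕ → MvPolynomial (Fin n) K}
    (hT : ∃ k ∈ T, μ k = 0) (hlab : ∀ k ∈ T, Lab m I f (μ k) (poly k))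
    (hpoly : ∀ k ∈ T, poly k ≠ 0) {τ : Mon n} {p : MvPolynomial (Fin n) K}
    (hτ : ¬ InLead m I τ) (hp : Lab m I f τ p) (hp0 : p ≠ 0)
    (hmin : ∀ τ', τ' ≼[m] τ → ¬ InLead m I τ' → LastDivisorMinimal m I f T μ poly τ') :
    InLead m I (m.degree p) ∨ ∃ τ', τ' ≼[m] τ ∧ ¬ InLead m I τ' ∧
      ∃ l, IsLastDivisor T μ τ' l ∧ τ' - μ l + m.degree (poly l) = m.degree p := by
  induction hs : m.toSyn τ using WellFoundedLT.induction generalizing τ p with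
  | ind s ih =>
    subst hs
    obtain ⟨k, hk, hk0⟩ := hT
    obtain ⟨l, hl⟩ := exists_isLastDivisor (T := T) (μ := μ) (σ := τ)
      ⟨k, hk, by rw [hk0]; exact zero_le⟩
    have hle := hmin τ le_rfl hτ l hl p hp
    rcases hle.eq_or_lt with he | hlt
    · exact Or.inr ⟨τ, le_rfl, hτ, l, hl, m.toSyn.injective he⟩
    have hlabl : Lab m I f τ (MvPolynomial.monomial (τ - μ l) (1 : K) * poly l) := by
      simpa [tsub_add_cancel_of_le hl.2.1] using (hlab l hl.1).monomial_mul (τ - μ l) one_ne_zero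
    rw [← degree_monomial_mul (m := m) (c := (1 : K)) one_ne_zero (hpoly l hl.1)] at hlt
    obtain ⟨c, hc, h⟩ := hp.exists_sub hlabl
    obtain ⟨hd, h0⟩ := degree_sub_C_mul c hlt
    rcases h with h | ⟨τ', hτ', hnl, hlab'⟩
    · exact Or.inl ⟨_, h, h0, hd.le⟩
    · rcases ih _ hτ' hnl hlab' h0 (fun τ'' h1 => hmin τ'' (h1.trans hτ'.le)) rfl with
        h | ⟨τ'', h1, h2⟩
      · rw [hd] at h
        exact Or.inl h
      · rw [hd] at h2
        exact Or.inr ⟨τ'', h1.trans hτ'.le, h2⟩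

/-- If every critical pair of last divisors has been superseded, then last divisors are minimal. -/
theorem lastDivisorMinimal {T : Finset ℕ} {μ : ℕ → Mon n}
    {poly : ℕ → MvPolynomial (Fin n) K}
    (hT : ∃ k ∈ T, μ k = 0) (hlab : ∀ k ∈ T, Lab m I f (μ k) (poly k))
    (hpoly : ∀ k ∈ T, poly k ≠ 0)
    (hprev : ∀ σ, ¬ InLead m I σ → ∀ k, IsLastDivisor T μ σ k →
      ¬ InLead m I (σ - μ k + m.degree (poly k)))
    (hpair : ∀ σ, ¬ InLead m I σ → ∀ k, IsLastDivisor T μ σ k → ∀ τ, τ ≺[m] σ →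
      ¬ InLead m I τ → ∀ l, IsLastDivisor T μ τ l →
      τ - μ l + m.degree (poly l) ≠ σ - μ k + m.degree (poly k))
    (σ : Mon n) (hσ : ¬ InLead m I σ) : LastDivisorMinimal m I f T μ poly σ := by
  induction hs : m.toSyn σ using WellFoundedLT.induction generalizing σ with
  | ind s ih =>
    subst hs
    intro k hk q hq
    by_contra hlt
    rw [not_le] at hlt
    have hlabk : Lab m I f σ (MvPolynomial.monomial (σ - μ k) (1 : K) * poly k) := by
      simpa [tsub_add_cancel_of_le hk.2.1] using (hlab k hk.1).monomial_mul (σ - μ k) one_ne_zero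
    have hdk := degree_monomial_mul (m := m) (u := σ - μ k) (c := (1 : K)) one_ne_zero
      (hpoly k hk.1)
    rw [← hdk] at hlt
    -- As q has the smaller head monomial, the combination keeps the head monomial of the multiple
    -- of `poly k`, while its label drops below σ.
    obtain ⟨c, hc, h⟩ := hlabk.exists_sub hq
    obtain ⟨hd, h0⟩ := degree_sub_C_mul c hlt
    rw [hdk] at hd
    rcases h with h | ⟨τ, hτ, hnl, hlab'⟩
    · exact hprev σ hσ k hk ⟨_, h, h0, hd.le⟩
    -- Minimality below σ yields a last divisor l at a smaller label with the same head monomial: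
    -- the configuration that `hpair` forbids.
    · rcases inLead_or_exists_isLastDivisor hT hlab hpoly hnl hlab' h0
        (fun τ' h1 h2 => ih _ (h1.trans_lt hτ) τ' h2 rfl) with h | ⟨τ', h1, h2, l, hl, h3⟩
      · rw [hd] at h
        exact hprev σ hσ k hk h
      · exact hpair σ hσ k hk τ' (h1.trans_lt hτ) h2 l hl (h3.trans hd)

/-- Under the same hypothesis, the polynomials indexed by `T` form a Gröbner basis of `I + (f)`
together with the elements of `I`. -/
theorem inLead_or_exists_degree_le {T : Finset ℕ} {μ : ℕ → Mon n}
    {poly : ℕ → MvPolynomial (Fin n) K}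
    (hT : ∃ k ∈ T, μ k = 0) (hlab : ∀ k ∈ T, Lab m I f (μ k) (poly k))
    (hpoly : ∀ k ∈ T, poly k ≠ 0)
    (hmin : ∀ τ, ¬ InLead m I τ → LastDivisorMinimal m I f T μ poly τ)
    {p h : MvPolynomial (Fin n) K} (hp : p - h * f ∈ I) (hp0 : p ≠ 0) :
    InLead m I (m.degree p) ∨ ∃ l ∈ T, m.degree (poly l) ≤ m.degree p := by
  rcases mem_or_exists_lab (m := m) hp with h | ⟨τ, -, hτ, hl⟩
  · exact Or.inl ⟨p, h, hp0, le_rfl⟩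
  · rcases inLead_or_exists_isLastDivisor hT hlab hpoly hτ hl hp0 (fun τ' _ => hmin τ') with
      h | ⟨τ', -, -, l, hl, h⟩
    · exact Or.inl h
    · exact Or.inr ⟨l, hl.1, by rw [← h]; exact le_add_self⟩

end Rewriters

end F5C

/-! ### Principal syzygies of homogeneous families and nonzerodivisors -/

section Syzygies

open MvPolynomial

/-- The homogeneous component of integral degree `d`; it vanishes for negative `d`. -/
noncomputable def MvPolynomial.intComponent {σ R : Type*} [CommRing R] (d : ℤ) :
    MvPolynomial σ R →ₗ[R] MvPolynomial σ R :=
  if 0 ≤ d then homogeneousComponent d.toNat else 0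

theorem MvPolynomial.intComponent_natCast {σ R : Type*} [CommRing R] (d : ℕ) :
    intComponent (σ := σ) (R := R) d = homogeneousComponent d := by
  simp [intComponent]

theorem MvPolynomial.intComponent_of_neg {σ R : Type*} [CommRing R] {d : ℤ} (hd : d < 0) :
    intComponent (σ := σ) (R := R) d = 0 := by
  simp [intComponent, not_le.mpr hd]

theorem MvPolynomial.coeff_intComponent {σ R : Type*} [CommRing R] (d : ℤ)
    (p : MvPolynomial σ R) (s : σ →₀ ℕ) :
    coeff s (intComponent d p) = if (s.degree : ℤ) = d then coeff s p else 0 := by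
  rcases lt_or_ge d 0 with h | h
  · rw [intComponent_of_neg h, if_neg (by omega)]
    simp
  · lift d to ℕ using h
    rw [intComponent_natCast, coeff_homogeneousComponent]
    simp

/-- Integral degrees make this hold without a case distinction: for d < e both sides vanish. -/
theorem MvPolynomial.intComponent_mul_of_isHomogeneous {σ R : Type*} [CommRing R] (d : ℤ)
    {q : MvPolynomial σ R} {e : ℕ} (hq : q.IsHomogeneous e) (p : MvPolynomial σ R) :
    intComponent d (p * q) = intComponent (d - e) p * q := by
  classical
  ext s
  rw [coeff_intComponent, coeff_mul, coeff_mul, ← Finset.sum_const_zero, ← Finset.sum_ite_irrel]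
  refine Finset.sum_congr rfl fun x hx => ?_
  rw [coeff_intComponent]
  by_cases h0 : coeff x.2 q = 0
  · simp [h0]
  have h1 : x.2.degree = e := by
    rw [Finsupp.degree_eq_weight_one]
    exact hq h0
  have h2 : s.degree = x.1.degree + e := by
    rw [← Finset.HasAntidiagonal.mem_antidiagonal.mp hx, map_add, h1]
  rw [h2, ite_mul, zero_mul]
  push_cast
  congr 1
  rw [eq_sub_iff_add_eq]

theorem MvPolynomial.intComponent_intComponent {σ R : Type*} [CommRing R] (d : ℤ)
    (p : MvPolynomial σ R) : intComponent d (intComponent d p) = intComponent d p := by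
  ext s
  simp only [coeff_intComponent]
  split_ifs <;> rfl

theorem MvPolynomial.sum_intComponent {σ R : Type*} [CommRing R] (p : MvPolynomial σ R) (e M : ℕ)
    (hM : p.totalDegree + e < M) :
    ∑ d ∈ Finset.range M, intComponent ((d : ℤ) - e) p = p := by
  ext s
  rw [coeff_sum]
  simp only [coeff_intComponent]
  by_cases h0 : coeff s p = 0
  · simp [h0]
  have hs : s.degree ≤ p.totalDegree := by
    have := le_totalDegree (mem_support_iff.mpr h0)
    rwa [Finsupp.degree_apply]
  rw [Finset.sum_eq_single (s.degree + e)]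
  · simp
  · intro b _ hb
    rw [if_neg]
    omega
  · intro h
    exact absurd (Finset.mem_range.mpr (by omega)) h

/-- Every syzygy of the subfamily of `F` indexed by `T` is a combination of principal syzygies. -/
def PrincipalOn {ι R : Type*} [CommRing R] (F : ι → R) (T : Finset ι) : Prop :=
  ∀ H : ι → R, ∑ i ∈ T, H i * F i = 0 →
    ∃ c : ι → ι → R, ∀ b ∈ T, H b = ∑ a ∈ T, (c a b - c b a) * F a

/-- Coefficients of principal syzygies matter only through their antisymmetrisation. This coordinate
form makes sense for every subset of the family, which allows elements to be removed one at a time.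
-/
theorem SyzygiesArePrincipal.principalOn {R : Type*} [CommRing R] {k : ℕ} {F : Fin k → R}
    (h : SyzygiesArePrincipal F) : PrincipalOn F Finset.univ := by
  intro H hH
  obtain ⟨c, hc⟩ := (Submodule.mem_span_range_iff_exists_fun R).mp (h H hH)
  refine ⟨fun a b => c (a, b), fun b _ => ?_⟩
  rw [← hc, Finset.sum_apply, Fintype.sum_prod_type]
  simp only [principalSyzygy, Pi.smul_apply, Pi.sub_apply, smul_eq_mul, Pi.single_apply, mul_sub,
    mul_ite, mul_one, mul_zero, Finset.sum_sub_distrib, sub_mul, Finset.sum_ite_eq,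
    Finset.mem_univ, if_true]
  congr 1
  rw [Finset.sum_comm]
  simp

variable {ι σ R : Type*} [DecidableEq ι] [CommRing R]

/-- The graded step in the removal of an element of positive degree from a family all of whose
syzygies are principal. -/
theorem PrincipalOn.of_insert_of_homogeneous {F : ι → MvPolynomial σ R} {e : ι → ℕ}
    (hF : ∀ i, (F i).IsHomogeneous (e i)) {T : Finset ι} {k : ι} (hk : k ∉ T) (hek : 0 < e k)
    (h : PrincipalOn F (insert k T)) (N : ℕ) :
    ∀ d : ℤ, d < N → ∀ H : ι → MvPolynomial σ R, ∑ i ∈ T, H i * F i = 0 →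
      (∀ i ∈ T, intComponent (d - e i) (H i) = H i) →
      ∃ c : ι → ι → MvPolynomial σ R, ∀ b ∈ T, H b = ∑ a ∈ T, (c a b - c b a) * F a := by
  induction N with
  | zero =>
    intro d hd H _ hHd
    refine ⟨0, fun b hb => ?_⟩
    rw [← hHd b hb, intComponent_of_neg (by push_cast at hd; omega)]
    simp
  | succ N ih =>
    intro d hd H hH hHd
    -- Extended by zero at k, the syzygy becomes one of the larger family.
    obtain ⟨c, hc⟩ := h (fun i => if i = k then 0 else H i) (by
      rw [Finset.sum_insert hk, if_pos rfl, zero_mul, zero_add, ← hH]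
      refine Finset.sum_congr rfl fun i hi => ?_
      rw [if_neg (by rintro rfl; exact hk hi)])
    set c' : ι → ι → MvPolynomial σ R := fun a b => intComponent (d - e a - e b) (c a b) with hc'
    have hcomp : ∀ b ∈ insert k T, intComponent (d - e b) (if b = k then 0 else H b) =
        ∑ a ∈ insert k T, (c' a b - c' b a) * F a := by
      intro b hb
      rw [hc b hb, map_sum]
      refine Finset.sum_congr rfl fun a _ => ?_
      rw [intComponent_mul_of_isHomogeneous _ (hF a), map_sub, hc']
      simp only
      rw [sub_right_comm d (e a : ℤ)]
    -- The vanishing k-th coordinate is itself a syzygy of the family on T, in degree d - e k, which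
    -- is smaller because e k > 0.
    have hk' := hcomp k (Finset.mem_insert_self k T)
    rw [if_pos rfl, map_zero, Finset.sum_insert hk, sub_self, zero_mul, zero_add] at hk'
    obtain ⟨c'', hc''⟩ := ih (d - e k) (by push_cast at hd; omega)
      (fun a => c' a k - c' k a) hk'.symm (by
        intro a _
        rw [hc', map_sub]
        simp only
        rw [sub_right_comm d (e k : ℤ), intComponent_intComponent, sub_right_comm d (e a : ℤ),
          intComponent_intComponent])
    -- By induction the coefficient of F k in H b is a combination of the F a with antisymmetric
    -- coefficients, so that term can be absorbed into the coefficients on T.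
    refine ⟨fun a b => c' a b - c'' a b * F k, fun b hb => ?_⟩
    have hbk : b ≠ k := by rintro rfl; exact hk hb
    have hb' := hcomp b (Finset.mem_insert_of_mem hb)
    rw [if_neg hbk, hHd b hb, Finset.sum_insert hk] at hb'
    have : c' k b - c' b k = - ∑ a ∈ T, (c'' a b - c'' b a) * F a := by
      rw [← hc'' b hb]
      ring
    rw [hb', this, neg_mul, Finset.sum_mul, neg_add_eq_sub, ← Finset.sum_sub_distrib]
    exact Finset.sum_congr rfl fun a _ => by ring

/-- Removing an element of positive degree from a homogeneous family all of whose syzygies are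
principal. -/
theorem PrincipalOn.of_insert {F : ι → MvPolynomial σ R} {e : ι → ℕ}
    (hF : ∀ i, (F i).IsHomogeneous (e i)) {T : Finset ι} {k : ι} (hk : k ∉ T) (hek : 0 < e k)
    (h : PrincipalOn F (insert k T)) : PrincipalOn F T := by
  intro H hH
  have key : ∀ d : ℕ, ∃ c : ι → ι → MvPolynomial σ R, ∀ b ∈ T,
      intComponent ((d : ℤ) - e b) (H b) = ∑ a ∈ T, (c a b - c b a) * F a := by
    intro d
    refine h.of_insert_of_homogeneous hF hk hek (d + 1) d (by push_cast; omega)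
      (fun b => intComponent ((d : ℤ) - e b) (H b)) ?_ fun i _ => intComponent_intComponent _ _
    rw [← map_zero (intComponent (d : ℤ)), ← hH, map_sum]
    exact Finset.sum_congr rfl fun i _ => (intComponent_mul_of_isHomogeneous _ (hF i) _).symm
  choose c hc using key
  -- Large enough for the components in degrees below M to recover every coordinate of H.
  set M := ∑ i ∈ T, ((H i).totalDegree + e i) + 1 with hM
  refine ⟨fun a b => ∑ d ∈ Finset.range M, c d a b, fun b hb => ?_⟩
  have hbM : (H b).totalDegree + e b < M :=
    Nat.lt_succ_of_le (Finset.single_le_sum (f := fun i => (H i).totalDegree + e i)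
      (fun _ _ => Nat.zero_le _) hb)
  rw [← sum_intComponent (H b) (e b) M hbM, Finset.sum_congr rfl fun d _ => hc d b hb,
    Finset.sum_comm]
  refine Finset.sum_congr rfl fun a _ => ?_
  rw [← Finset.sum_mul, Finset.sum_sub_distrib]

theorem PrincipalOn.subset {F : ι → MvPolynomial σ R} {e : ι → ℕ}
    (hF : ∀ i, (F i).IsHomogeneous (e i)) (he : ∀ i, 0 < e i) {T U : Finset ι} (hTU : T ⊆ U)
    (h : PrincipalOn F U) : PrincipalOn F T := by
  induction hs : (U \ T) using Finset.induction_on generalizing T with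
  | empty =>
    rw [Finset.sdiff_eq_empty_iff_subset] at hs
    rwa [hTU.antisymm hs]
  | insert k S hkS ih =>
    have hk : k ∈ U \ T := hs ▸ Finset.mem_insert_self k S
    rw [Finset.mem_sdiff] at hk
    refine PrincipalOn.of_insert hF hk.2 (he k) (ih (Finset.insert_subset hk.1 hTU) ?_)
    rw [Finset.sdiff_insert, hs, Finset.erase_insert hkS]

/-- An element of a family with principal syzygies is a nonzerodivisor modulo the others. -/
theorem PrincipalOn.mem_span_of_mul_mem {A : Type*} [CommRing A] {F : ι → A} {T : Finset ι} {k : ι}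
    (hk : k ∉ T) (h : PrincipalOn F (insert k T)) {p : A}
    (hp : p * F k ∈ Ideal.span (F '' T)) : p ∈ Ideal.span (F '' T) := by
  obtain ⟨g, hg⟩ : ∃ g : ι → A, ∑ i ∈ T, g i * F i = p * F k := by
    obtain ⟨g, hg⟩ := (Submodule.mem_span_image_finset_iff_exists_fun A).mp hp
    refine ⟨fun i => if h : i ∈ T then g ⟨i, h⟩ else 0, ?_⟩
    rw [← hg, ← Finset.sum_coe_sort]
    simp
  obtain ⟨c, hc⟩ := h (fun i => if i = k then p else - g i) (by
    rw [Finset.sum_insert hk, if_pos rfl, ← hg, ← Finset.sum_add_distrib]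
    refine Finset.sum_eq_zero fun i hi => ?_
    rw [if_neg (by rintro rfl; exact hk hi)]
    simp)
  -- The k-th coordinate is p; its diagonal coefficient cancels, leaving only multiples of F a with
  -- a in T.
  have := hc k (Finset.mem_insert_self k T)
  rw [if_pos rfl, Finset.sum_insert hk, sub_self, zero_mul, zero_add] at this
  rw [this]
  exact Ideal.sum_mem _ fun a ha => Ideal.mul_mem_left _ _ (Ideal.subset_span ⟨a, ha, rfl⟩)

end Syzygies

/-! ### Regularity of the sorted input -/

namespace F5C

/-- In a sorted list of nonzero homogeneous polynomials with principal syzygies, every element is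
a nonzerodivisor modulo its predecessors. -/
theorem mem_span_of_mul_mem {n : ℕ} {K : Type*} [Field K] {m : MonomialOrder (Fin n)} {k : ℕ}
    {F : Fin k → MvPolynomial (Fin n) K} (hF0 : ∀ i, F i ≠ 0)
    (hhom : ∀ i, ∃ d, (F i).IsHomogeneous d) (hsyz : SyzygiesArePrincipal F)
    {L rest : List (MvPolynomial (Fin n) K)} {f : MvPolynomial (Fin n) K}
    (hperm : (L ++ f :: rest).Perm (List.ofFn F)) (hsort : IsSorted m (L ++ f :: rest))
    {h : MvPolynomial (Fin n) K} (hh : h * f ∈ Ideal.span {p | p ∈ L}) :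
    h ∈ Ideal.span {p | p ∈ L} := by
  have hmem : ∀ p, p ∈ L ++ f :: rest ↔ ∃ i, F i = p := fun p => by
    rw [hperm.mem_iff, List.mem_ofFn]
  choose e he using hhom
  -- Passing to subfamilies needs positive degrees. If a constant occurs, sorting puts a constant
  -- first, so the ideal of the predecessors is zero (no predecessor) or the whole ring.
  by_cases hconst : ∃ i, e i = 0
  · obtain ⟨i, hi⟩ := hconst
    rcases L with _ | ⟨g, L⟩
    · obtain ⟨j, rfl⟩ := (hmem f).mp (by simp)
      simp only [List.not_mem_nil, Set.ofPred_false, Ideal.span_empty, Ideal.mem_bot,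
        mul_eq_zero] at hh ⊢
      exact hh.resolve_right (hF0 j)
    · have hg : g.totalDegree ≤ (F i).totalDegree := by
        have hi' := (hmem (F i)).mpr ⟨i, rfl⟩
        rw [List.cons_append, List.mem_cons] at hi'
        rcases hi' with h | h
        · rw [h]
        · rcases (List.pairwise_cons.mp hsort).1 _ h with h | h
          · exact h.le
          · exact h.1.le
      rw [(he i).totalDegree (hF0 i), hi, Nat.le_zero] at hg
      obtain ⟨j, hj⟩ := (hmem g).mp (by simp)
      have hgC := MvPolynomial.totalDegree_eq_zero_iff_eq_C.mp hg
      have hc : g.coeff 0 ≠ 0 := by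
        intro h0
        rw [h0, map_zero] at hgC
        exact hF0 j (hj.trans hgC)
      have : (Ideal.span {p | p ∈ g :: L}) = ⊤ := by
        refine Ideal.eq_top_of_isUnit_mem _ (Ideal.subset_span (by simp : g ∈ {p | p ∈ g :: L})) ?_
        rw [hgC]
        exact (IsUnit.mk0 _ hc).map MvPolynomial.C
      rw [this]
      trivial
  · push Not at hconst
    -- The permutation is lifted to indices, which have no repetitions, whereas the polynomials
    -- might.
    have hforall : List.Forall₂ (fun p i => p = F i) (List.ofFn F) (List.finRange k) := by
      rw [List.ofFn_eq_map, List.forall₂_map_left_iff]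
      exact List.forall₂_same.mpr fun _ _ => rfl
    obtain ⟨l, hl, hlp⟩ := List.perm_comp_forall₂ hperm hforall
    have hlmap : L ++ f :: rest = l.map F := by
      rw [← List.forall₂_eq_eq_eq, List.forall₂_map_right_iff]
      exact hl
    have hnd : l.Nodup := hlp.nodup_iff.mpr (List.nodup_finRange k)
    obtain ⟨l₁, l₂, rfl, h1, h2⟩ := List.append_eq_map_iff.mp hlmap
    obtain ⟨i, l₃, rfl, rfl, -⟩ := List.map_eq_cons_iff.mp h2
    have hset : {p | p ∈ L} = F '' (l₁.toFinset : Set (Fin k)) := by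
      ext p
      simp [← h1]
    rw [hset] at hh ⊢
    have hi : i ∉ l₁.toFinset := by
      rw [List.mem_toFinset]
      intro hi
      exact (List.nodup_append.mp hnd).2.2 i hi i (by simp) rfl
    exact (hsyz.principalOn.subset he (fun i => Nat.pos_of_ne_zero (hconst i))
      (Finset.subset_univ _)).mem_span_of_mul_mem hi hh

end F5C

/-! ### Invariants of a single iteration and their preservation -/

namespace F5C

section Invariants

variable {n : ℕ} {K : Type*} [Field K]

/-- The indices in `prev` carry a Gröbner basis of `I`, with the head monomials of `B`. -/
structure PrevInv (m : MonomialOrder (Fin n)) (I : Ideal (MvPolynomial (Fin n) K))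
    (S : State n K) : Prop where
  mem : ∀ j ∈ S.prev, S.poly j ∈ I
  ne_zero : ∀ j ∈ S.prev, S.poly j ≠ 0
  groebner : ∀ g ∈ I, g ≠ 0 → ∃ j ∈ S.prev, m.degree (S.poly j) ≤ m.degree g
  sig : ∀ j ∈ S.prev, S.sig j = (0, j)
  mem_B : ∀ b ∈ S.B, b ∈ I
  degree_B : ∀ j ∈ S.prev, ∃ b ∈ S.B, b ≠ 0 ∧ m.degree b = m.degree (S.poly j)
  rules : ∀ l ∈ S.prev, ∀ ρ ∈ S.rules l, ∃ j ∈ S.prev, j < l ∧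
    ρ.1 = (m.degree (S.poly j) ⊔ m.degree (S.poly l)) - m.degree (S.poly l)

/-- A rule, or for a previous index `l` the head monomial of an earlier polynomial, forbids the
critical pair of `k` and `l`. -/
def Handled (m : MonomialOrder (Fin n)) (S : State n K) (k l : ℕ) : Prop :=
  (∃ j, k < j ∧ j ≤ S.num ∧ (S.sig j).1 ≤ S.mult m k l + (S.sig k).1) ∨
  (S.idx ≤ l ∧ ∃ j, l < j ∧ j ≤ S.num ∧ (S.sig j).1 ≤ S.mult m l k + (S.sig l).1) ∨
  (l ∈ S.prev ∧ ∃ j ∈ S.prev, j < l ∧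
    m.degree (S.poly j) ≤ S.mult m l k + m.degree (S.poly l))

/-- The properties of a pending critical pair. -/
structure ValidPair (m : MonomialOrder (Fin n)) (I : Ideal (MvPolynomial (Fin n) K))
    (S : State n K) (c : CPair n) : Prop where
  k_mem : c.k ∈ S.curr
  l_mem : c.l ∈ S.curr
  ne : c.k ≠ c.l
  idx_le : S.idx ≤ c.k
  u_eq : c.u = S.mult m c.k c.l
  v_eq : c.v = S.mult m c.l c.k
  notInLead : ¬ InLead m I (c.u + (S.sig c.k).1)
  not_lt : ¬ SigLT m (mulSig c.u (S.sig c.k)) (mulSig c.v (S.sig c.l))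

/-- The invariant of `Partial_Basis`, where `A` is the set of the indices that are not yet in
`curr`, and `Q` the set of all pending critical pairs. -/
structure IterInv (m : MonomialOrder (Fin n)) (I : Ideal (MvPolynomial (Fin n) K))
    (f : MvPolynomial (Fin n) K) (S : State n K) (A : Finset ℕ) (Q : Set (CPair n)) : Prop where
  prevInv : PrevInv m I S
  mem_prev : ∀ j, j ∈ S.prev ↔ 1 ≤ j ∧ j < S.idx
  one_le_idx : 1 ≤ S.idx
  idx_le : S.idx ≤ S.num
  sig_idx : S.sig S.idx = (0, S.idx)
  lab_idx : Lab m I f 0 (S.poly S.idx)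
  poly_idx : S.poly S.idx ≠ 0
  sig_snd : ∀ k, S.idx < k → k ≤ S.num → (S.sig k).2 = S.idx
  lab : ∀ k, S.idx < k → k ≤ S.num → Lab m I f (S.sig k).1 (S.poly k)
  notInLead : ∀ k, S.idx < k → k ≤ S.num → ¬ InLead m I (S.sig k).1
  rules : S.rules S.idx =
    (List.range' (S.idx + 1) (S.num - S.idx)).map fun k => ((S.sig k).1, k)
  mem_curr_or : ∀ k, k ∈ S.curr ∨ k ∈ A ↔ 1 ≤ k ∧ k ≤ S.num
  disjoint : ∀ k ∈ S.curr, k ∉ A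
  mem_curr : ∀ k, 1 ≤ k → k ≤ S.idx → k ∈ S.curr
  zero : S.zeroReductions = 0
  valid : ∀ c ∈ Q, ValidPair m I S c
  cover : ∀ k ∈ S.curr, ∀ l ∈ S.curr, S.idx ≤ k →
    SigLT m (mulSig (S.mult m l k) (S.sig l)) (mulSig (S.mult m k l) (S.sig k)) →
    ¬ InLead m I (S.mult m k l + (S.sig k).1) →
    (S.idx ≤ l → ¬ InLead m I (S.mult m l k + (S.sig l).1)) →
    (⟨m.degree (S.poly k) ⊔ m.degree (S.poly l), k, S.mult m k l, l, S.mult m l k⟩ : CPair n) ∈ Q ∨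
      Handled m S k l

variable {m : MonomialOrder (Fin n)} {I : Ideal (MvPolynomial (Fin n) K)}
  {f : MvPolynomial (Fin n) K} {S S' : State n K} {A A' : Finset ℕ} {Q Q' : Set (CPair n)}

theorem SigLT.irrefl (a : Sig n) : ¬ SigLT m a a := by
  rintro (h | h)
  · exact lt_irrefl _ h
  · exact lt_irrefl _ h.2

theorem SigLT.asymm {a b : Sig n} (h : SigLT m a b) : ¬ SigLT m b a := by
  rintro (h' | ⟨h', h''⟩) <;> rcases h with h | ⟨h1, h2⟩
  · omega
  · omega
  · omega
  · exact lt_asymm h2 h''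

theorem SigLT.of_not {a b : Sig n} (h : ¬ SigLT m a b) (hne : b ≠ a) (hs : a.2 = b.2) :
    b.1 ≺[m] a.1 := by
  refine lt_of_le_of_ne (not_lt.mp fun h' => h (Or.inr ⟨hs, h'⟩)) fun h' => hne ?_
  exact Prod.ext (m.toSyn.injective h') hs.symm

theorem mult_congr {k l : ℕ} (hk : S'.poly k = S.poly k) (hl : S'.poly l = S.poly l) :
    S'.mult m k l = S.mult m k l := by
  rw [State.mult, State.mult, hk, hl]

theorem PrevInv.congr (h : PrevInv m I S) (hprev : S'.prev = S.prev) (hB : S'.B = S.B)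
    (hsig : ∀ j ∈ S.prev, S'.sig j = S.sig j) (hpoly : ∀ j ∈ S.prev, S'.poly j = S.poly j)
    (hrules : ∀ j ∈ S.prev, S'.rules j = S.rules j) : PrevInv m I S' where
  mem j hj := by
    rw [hprev] at hj
    rw [hpoly j hj]
    exact h.mem j hj
  ne_zero j hj := by
    rw [hprev] at hj
    rw [hpoly j hj]
    exact h.ne_zero j hj
  groebner g hg hg0 := by
    obtain ⟨j, hj, hd⟩ := h.groebner g hg hg0
    exact ⟨j, hprev ▸ hj, by rwa [hpoly j hj]⟩
  sig j hj := by
    rw [hprev] at hj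
    rw [hsig j hj]
    exact h.sig j hj
  mem_B := by
    rw [hB]
    exact h.mem_B
  degree_B j hj := by
    rw [hprev] at hj
    rw [hpoly j hj, hB]
    exact h.degree_B j hj
  rules l hl ρ hρ := by
    rw [hprev] at hl
    rw [hrules l hl] at hρ
    obtain ⟨j, hj, hjl, hρ'⟩ := h.rules l hl ρ hρ
    exact ⟨j, hprev ▸ hj, hjl, by rwa [hpoly j hj, hpoly l hl]⟩

/-- Here the Gröbner property of the previous basis enters: the test on finitely many head monomials
decides membership in the head ideal of I. -/
theorem PrevInv.topRedByPrev_iff (h : PrevInv m I S) {w : Mon n} :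
    S.TopRedByPrev m w ↔ InLead m I w := by
  constructor
  · rintro ⟨j, hj, hd⟩
    exact ⟨_, h.mem j hj, h.ne_zero j hj, hd⟩
  · rintro ⟨g, hg, hg0, hd⟩
    obtain ⟨j, hj, hd'⟩ := h.groebner g hg hg0
    exact ⟨j, hj, hd'.trans hd⟩

/-- If lcm(HM j, HM l)/HM l divides v, then HM j divides v · HM l. Thus the rules of a previous
index discard a component only in favour of an earlier element of the previous basis. -/
theorem PrevInv.exists_of_rewritable (h : PrevInv m I S) {v : Mon n} {l : ℕ} (hl : l ∈ S.prev)
    (hr : S.Rewritable v l) :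
    ∃ j ∈ S.prev, j < l ∧ m.degree (S.poly j) ≤ v + m.degree (S.poly l) := by
  unfold State.Rewritable State.findRewriting at hr
  rw [h.sig l hl] at hr
  split at hr
  · rename_i ρ hρ
    have hρ' := List.mem_reverse.mp (List.mem_of_find?_eq_some hρ)
    have hd := List.find?_some hρ
    obtain ⟨j, hj, hjl, he⟩ := h.rules l hl ρ hρ'
    refine ⟨j, hj, hjl, ?_⟩
    simp only [add_zero, decide_eq_true_eq] at hd
    rw [he, tsub_le_iff_right] at hd
    exact le_sup_left.trans hd
  · exact absurd rfl hr

/-- Within an iteration indices only accumulate and signatures never change, so a forbidden pair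
remains forbidden. -/
theorem Handled.congr {k l : ℕ} (h : Handled m S k l) (hprev : S'.prev = S.prev)
    (hidx : S'.idx = S.idx) (hnum : S.num ≤ S'.num) (hsig : ∀ k, k ≤ S.num → S'.sig k = S.sig k)
    (hpoly : ∀ j ∈ S.prev, S'.poly j = S.poly j) (hk : S'.poly k = S.poly k)
    (hl : S'.poly l = S.poly l) (hkn : k ≤ S.num) (hln : l ≤ S.num) : Handled m S' k l := by
  unfold Handled
  rw [mult_congr hk hl, mult_congr hl hk, hsig k hkn, hsig l hln, hprev, hidx, hl]
  rcases h with ⟨j, h1, h2, h3⟩ | ⟨h0, j, h1, h2, h3⟩ | ⟨h0, j, h1, h2, h3⟩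
  · exact Or.inl ⟨j, h1, h2.trans hnum, by rwa [hsig j h2]⟩
  · exact Or.inr (Or.inl ⟨h0, j, h1, h2.trans hnum, by rwa [hsig j h2]⟩)
  · exact Or.inr (Or.inr ⟨h0, j, h1, h2, by rwa [hpoly j h1]⟩)

namespace IterInv

theorem le_num (h : IterInv m I f S A Q) {k : ℕ} (hk : k ∈ S.curr) : k ≤ S.num :=
  ((h.mem_curr_or k).mp (Or.inl hk)).2

theorem prev_subset (h : IterInv m I f S A Q) {k : ℕ} (hk : k ∈ S.prev) : k ∈ S.curr :=
  have hk' := (h.mem_prev k).mp hk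
  h.mem_curr k hk'.1 hk'.2.le

theorem sig_snd' (h : IterInv m I f S A Q) {k : ℕ} (h1 : S.idx ≤ k) (h2 : k ≤ S.num) :
    (S.sig k).2 = S.idx := by
  rcases h1.eq_or_lt with rfl | h1
  · rw [h.sig_idx]
  · exact h.sig_snd k h1 h2

theorem lab' (h : IterInv m I f S A Q) {k : ℕ} (h1 : S.idx ≤ k) (h2 : k ≤ S.num) :
    Lab m I f (S.sig k).1 (S.poly k) := by
  rcases h1.eq_or_lt with rfl | h1
  · rw [h.sig_idx]
    exact h.lab_idx
  · exact h.lab k h1 h2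

theorem mem_prev_of_lt (h : IterInv m I f S A Q) {k : ℕ} (hk : k ∈ S.curr) (h1 : k < S.idx) :
    k ∈ S.prev :=
  (h.mem_prev k).mpr ⟨((h.mem_curr_or k).mp (Or.inl hk)).1, h1⟩

theorem idx_lt_of_mem (h : IterInv m I f S A Q) {k : ℕ} (hk : k ∈ A) : S.idx < k := by
  by_contra hlt
  have := ((h.mem_curr_or k).mp (Or.inr hk)).1
  exact h.disjoint k (h.mem_curr k this (not_lt.mp hlt)) hk

theorem poly_ne_zero (hnzd : ∀ h, h * f ∈ I → h ∈ I) (h : IterInv m I f S A Q) {k : ℕ}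
    (h1 : 1 ≤ k) (h2 : k ≤ S.num) : S.poly k ≠ 0 := by
  rcases lt_trichotomy k S.idx with hk | rfl | hk
  · exact h.prevInv.ne_zero k ((h.mem_prev k).mpr ⟨h1, hk⟩)
  -- The label 1 of the new generator may lie in the head ideal (when I is the whole ring), so
  -- nonvanishing here cannot come from the label; it comes from f ≠ 0.
  · exact h.poly_idx
  · exact (h.lab k hk h2).ne_zero hnzd (h.notInLead k hk h2)

/-- `Find_Rewriting` for indices of the current iteration. -/
theorem findRewriting_spec (h : IterInv m I f S A Q) (u : Mon n) {k : ℕ} (h1 : S.idx ≤ k)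
    (h2 : k ≤ S.num) :
    (S.findRewriting u k = k ∧ ∀ j, k < j → j ≤ S.num → ¬ (S.sig j).1 ≤ u + (S.sig k).1) ∨
    (S.findRewriting u k ≠ k ∧ ∃ j, k < j ∧ j ≤ S.num ∧ (S.sig j).1 ≤ u + (S.sig k).1) := by
  have hmem : ∀ j, S.idx < j → j ≤ S.num → ((S.sig j).1, j) ∈ (S.rules S.idx).reverse := by
    intro j hj1 hj2
    rw [List.mem_reverse, h.rules, List.mem_map]
    exact ⟨j, List.mem_range'_1.mpr (by omega), rfl⟩
  -- Rules are appended in the order of their indices, so the most recent applicable rule is the one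
  -- with the largest index.
  have hpair : (S.rules S.idx).reverse.Pairwise fun x y => y.2 < x.2 := by
    rw [List.pairwise_reverse, h.rules, List.pairwise_map]
    exact List.pairwise_lt_range'
  unfold State.findRewriting
  rw [h.sig_snd' h1 h2]
  split
  · rename_i ρ hρ
    obtain ⟨hd, as, bs, hsplit, has⟩ := List.find?_eq_some_iff_append.mp hρ
    have hlast : ∀ j, ρ.2 < j → j ≤ S.num → S.idx < j → ¬ (S.sig j).1 ≤ u + (S.sig k).1 := by
      intro j hj1 hj2 hj3
      have hj := hmem j hj3 hj2
      rw [hsplit] at hj hpair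
      rcases List.mem_append.mp hj with hj | hj
      · simpa using has _ hj
      · rcases List.mem_cons.mp hj with hj | hj
        · rw [← hj] at hj1
          exact absurd hj1 (lt_irrefl _)
        · have := (List.pairwise_cons.mp (List.pairwise_append.mp hpair).2.1).1 _ hj
          exact absurd this (not_lt.mpr hj1.le)
    have hρ' := List.mem_reverse.mp (List.mem_of_find?_eq_some hρ)
    rw [h.rules, List.mem_map] at hρ'
    obtain ⟨j, hj, rfl⟩ := hρ'
    rw [List.mem_range'_1] at hj
    simp only [decide_eq_true_eq] at hd hlast ⊢
    -- The rule found cannot be older than k, because the rule of k itself would apply too.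
    rcases lt_trichotomy j k with hjk | rfl | hjk
    · exact absurd le_add_self (hlast k hjk h2 (by omega))
    · exact Or.inl ⟨rfl, fun i hi1 hi2 => hlast i hi1 hi2 (by omega)⟩
    · exact Or.inr ⟨hjk.ne', j, hjk, by omega, hd⟩
  · rename_i hnone
    refine Or.inl ⟨rfl, fun j hj1 hj2 => ?_⟩
    simpa using List.find?_eq_none.mp hnone _ (hmem j (by omega) hj2)

theorem rewritable_iff (h : IterInv m I f S A Q) (u : Mon n) {k : ℕ} (h1 : S.idx ≤ k)
    (h2 : k ≤ S.num) :
    S.Rewritable u k ↔ ∃ j, k < j ∧ j ≤ S.num ∧ (S.sig j).1 ≤ u + (S.sig k).1 := by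
  rcases h.findRewriting_spec u h1 h2 with ⟨h3, h4⟩ | ⟨h3, h4⟩
  · refine iff_of_false (fun hr => hr h3) ?_
    rintro ⟨j, hj1, hj2, hj3⟩
    exact h4 j hj1 hj2 hj3
  · exact iff_of_true h3 h4

theorem handled_of_rewritable (h : IterInv m I f S A Q) {c : CPair n} (hc : ValidPair m I S c)
    (hr : S.Rewritable c.u c.k ∨ S.Rewritable c.v c.l) : Handled m S c.k c.l := by
  rw [hc.u_eq, hc.v_eq] at hr
  rcases hr with hr | hr
  · exact Or.inl ((h.rewritable_iff _ hc.idx_le (h.le_num hc.k_mem)).mp hr)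
  · rcases le_or_gt S.idx c.l with hl | hl
    · exact Or.inr (Or.inl ⟨hl, (h.rewritable_iff _ hl (h.le_num hc.l_mem)).mp hr⟩)
    · have hl' := h.mem_prev_of_lt hc.l_mem hl
      exact Or.inr (Or.inr ⟨hl', h.prevInv.exists_of_rewritable hl' hr⟩)

/-- If the two components had equal signatures, the one with the smaller index would be rewritable
by the other; so the comparison is strict and the larger label survives. A component from the
previous basis lies in I and does not affect the label. -/
theorem lab_sPolynomial (hnzd : ∀ h, h * f ∈ I → h ∈ I) (h : IterInv m I f S A Q) {c : CPair n}
    (hc : ValidPair m I S c) (hk : ¬ S.Rewritable c.u c.k) (hl : ¬ S.Rewritable c.v c.l) :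
    Lab m I f (c.u + (S.sig c.k).1) (m.sPolynomial (S.poly c.k) (S.poly c.l)) := by
  have hkn := h.le_num hc.k_mem
  have hln := h.le_num hc.l_mem
  have hk0 := h.poly_ne_zero hnzd (h.one_le_idx.trans hc.idx_le) hkn
  have hl0 := h.poly_ne_zero hnzd ((h.mem_curr_or c.l).mp (Or.inl hc.l_mem)).1 hln
  have hlabk : Lab m I f (c.u + (S.sig c.k).1)
      (MvPolynomial.monomial c.u (m.leadingCoeff (S.poly c.l)) * S.poly c.k) :=
    (h.lab' hc.idx_le hkn).monomial_mul _ (m.leadingCoeff_ne_zero_iff.mpr hl0)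
  have hdef : m.sPolynomial (S.poly c.k) (S.poly c.l) =
      MvPolynomial.monomial c.u (m.leadingCoeff (S.poly c.l)) * S.poly c.k -
      MvPolynomial.monomial c.v (m.leadingCoeff (S.poly c.k)) * S.poly c.l := by
    rw [m.sPolynomial_def, hc.u_eq, hc.v_eq, State.mult, State.mult,
      sup_comm (m.degree (S.poly c.l))]
  rw [hdef]
  rcases le_or_gt S.idx c.l with hidx | hidx
  · have hlabl : Lab m I f (c.v + (S.sig c.l).1)
        (MvPolynomial.monomial c.v (m.leadingCoeff (S.poly c.k)) * S.poly c.l) :=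
      (h.lab' hidx hln).monomial_mul _ (m.leadingCoeff_ne_zero_iff.mpr hk0)
    refine hlabk.sub hlabl ?_
    refine SigLT.of_not hc.not_lt (fun he => ?_) ?_
    · have he1 : c.v + (S.sig c.l).1 = c.u + (S.sig c.k).1 := congrArg Prod.fst he
      rcases lt_or_gt_of_ne hc.ne with hlt | hlt
      · exact hk ((h.rewritable_iff _ hc.idx_le hkn).mpr ⟨c.l, hlt, hln, he1 ▸ le_add_self⟩)
      · exact hl ((h.rewritable_iff _ hidx hln).mpr ⟨c.k, hlt, hkn, he1 ▸ le_add_self⟩)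
    · exact (h.sig_snd' hc.idx_le hkn).trans (h.sig_snd' hidx hln).symm
  · refine hlabk.congr ?_
    rw [sub_sub_cancel_left]
    exact I.neg_mem (I.mul_mem_left _ (h.prevInv.mem _ (h.mem_prev_of_lt hc.l_mem hidx)))

/-- The invariant is kept when the polynomials in `curr` do not change, the new labels are
admissible and the pairs that disappear are handled. -/
theorem extend (h : IterInv m I f S A Q) (hprev : S'.prev = S.prev) (hB : S'.B = S.B)
    (hidx : S'.idx = S.idx) (hcurr : S'.curr = S.curr) (hzero : S'.zeroReductions = 0)
    (hnum : S.num ≤ S'.num) (hsig : ∀ k, k ≤ S.num → S'.sig k = S.sig k)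
    (hpoly : ∀ k ∈ S.curr, S'.poly k = S.poly k)
    (hrules : ∀ j, j < S.idx → S'.rules j = S.rules j)
    (hrules' : S'.rules S.idx =
      (List.range' (S.idx + 1) (S'.num - S.idx)).map fun k => ((S'.sig k).1, k))
    (hsnd : ∀ k, S.num < k → k ≤ S'.num → (S'.sig k).2 = S.idx ∧ ¬ InLead m I (S'.sig k).1)
    (hlab : ∀ k, S.idx < k → k ≤ S'.num → Lab m I f (S'.sig k).1 (S'.poly k))
    (hA : ∀ k, k ∈ S.curr ∨ k ∈ A' ↔ 1 ≤ k ∧ k ≤ S'.num) (hdisj : ∀ k ∈ S.curr, k ∉ A')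
    (hQ : ∀ c ∈ Q', c ∈ Q) (hQ' : ∀ c ∈ Q, c ∈ Q' ∨ Handled m S' c.k c.l) :
    IterInv m I f S' A' Q' := by
  have hidxc : S.idx ∈ S.curr := h.mem_curr _ h.one_le_idx le_rfl
  refine
    { prevInv := h.prevInv.congr hprev hB (fun j hj => hsig j (h.le_num (h.prev_subset hj)))
        (fun j hj => hpoly j (h.prev_subset hj)) fun j hj => hrules j ((h.mem_prev j).mp hj).2
      mem_prev := by rw [hprev, hidx]; exact h.mem_prev
      one_le_idx := hidx ▸ h.one_le_idx
      idx_le := hidx ▸ h.idx_le.trans hnum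
      sig_idx := by rw [hidx, hsig _ h.idx_le]; exact h.sig_idx
      lab_idx := by rw [hidx, hpoly _ hidxc]; exact h.lab_idx
      poly_idx := by rw [hidx, hpoly _ hidxc]; exact h.poly_idx
      sig_snd := fun k hk1 hk2 => ?_
      lab := by rw [hidx]; exact hlab
      notInLead := fun k hk1 hk2 => ?_
      rules := by rw [hidx]; exact hrules'
      mem_curr_or := by rw [hcurr]; exact hA
      disjoint := by rw [hcurr]; exact hdisj
      mem_curr := by rw [hcurr, hidx]; exact h.mem_curr
      zero := hzero
      valid := fun c hc => ?_
      cover := fun k hk l hl => ?_ }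
  · rw [hidx] at hk1 ⊢
    rcases le_or_gt k S.num with hk | hk
    · rw [hsig k hk]
      exact h.sig_snd k hk1 hk
    · exact (hsnd k hk hk2).1
  · rw [hidx] at hk1
    rcases le_or_gt k S.num with hk | hk
    · rw [hsig k hk]
      exact h.notInLead k hk1 hk
    · exact (hsnd k hk hk2).2
  · have hv := h.valid c (hQ c hc)
    have hk := hpoly _ hv.k_mem
    have hl := hpoly _ hv.l_mem
    have hsk := hsig _ (h.le_num hv.k_mem)
    have hsl := hsig _ (h.le_num hv.l_mem)
    exact
      { k_mem := hcurr ▸ hv.k_mem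
        l_mem := hcurr ▸ hv.l_mem
        ne := hv.ne
        idx_le := hidx ▸ hv.idx_le
        u_eq := by rw [mult_congr hk hl]; exact hv.u_eq
        v_eq := by rw [mult_congr hl hk]; exact hv.v_eq
        notInLead := by rw [hsk]; exact hv.notInLead
        not_lt := by rw [hsk, hsl]; exact hv.not_lt }
  · rw [hcurr] at hk hl
    have hpk := hpoly _ hk
    have hpl := hpoly _ hl
    have hkn := h.le_num hk
    have hln := h.le_num hl
    rw [mult_congr hpk hpl, mult_congr hpl hpk, hsig k hkn, hsig l hln, hpk, hpl, hidx]
    intro h1 h2 h3 h4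
    have hH : Handled m S k l → Handled m S' k l := fun hH =>
      hH.congr hprev hidx hnum hsig (fun j hj => hpoly j (h.prev_subset hj)) hpk hpl hkn hln
    rcases h.cover k hk l hl h1 h2 h3 h4 with h5 | h5
    · exact hQ' _ h5
    · exact Or.inr (hH h5)

/-- The invariant depends only on the data of the algorithm other than `pairs`, `rest`, `ctrl`. -/
theorem of_eq (h : IterInv m I f S A Q) (hprev : S'.prev = S.prev) (hB : S'.B = S.B)
    (hidx : S'.idx = S.idx) (hcurr : S'.curr = S.curr) (hzero : S'.zeroReductions = S.zeroReductions)
    (hnum : S'.num = S.num) (hsig : S'.sig = S.sig) (hpoly : S'.poly = S.poly)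
    (hrules : S'.rules = S.rules) (hA : ∀ k, k ∈ A' ↔ k ∈ A)
    (hQ : ∀ c ∈ Q', c ∈ Q) (hQ' : ∀ c ∈ Q, c ∈ Q' ∨ Handled m S c.k c.l) :
    IterInv m I f S' A' Q' := by
  refine h.extend hprev hB hidx hcurr (hzero.trans h.zero) hnum.ge (fun _ _ => by rw [hsig])
    (fun _ _ => by rw [hpoly]) (fun _ _ => by rw [hrules]) ?_ ?_ ?_ ?_ ?_ hQ
    fun c hc => (hQ' c hc).imp_right fun hH => ?_
  · rw [hrules, hnum, hsig]
    exact h.rules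
  · intro k h1 h2
    omega
  · rw [hnum, hsig, hpoly]
    exact h.lab
  · simpa only [hA, hnum] using h.mem_curr_or
  · simpa only [hA] using h.disjoint
  · have hv := h.valid c hc
    exact hH.congr hprev hidx hnum.ge (fun _ _ => by rw [hsig]) (fun _ _ => by rw [hpoly])
      (by rw [hpoly]) (by rw [hpoly]) (h.le_num hv.k_mem) (h.le_num hv.l_mem)

/-- Pairs refer only to `curr`, so a polynomial still being reduced may be replaced freely, as long
as its label is kept. -/
theorem setPoly (h : IterInv m I f S A Q) {k : ℕ} (hk : k ∈ A) {p : MvPolynomial (Fin n) K}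
    (hp : Lab m I f (S.sig k).1 p) {c : Ctrl n} (hA : ∀ k, k ∈ A' ↔ k ∈ A) :
    IterInv m I f ((S.setPoly k p).goto c) A' Q := by
  refine h.extend rfl rfl rfl rfl h.zero le_rfl (fun _ _ => rfl) (fun j hj => ?_)
    (fun _ _ => rfl) h.rules ?_ (fun j hj1 hj2 => ?_) ?_ ?_ (fun _ => id) fun _ => Or.inl
  · exact Function.update_of_ne (by rintro rfl; exact h.disjoint _ hj hk) _ _
  · intro j h1 h2
    exact absurd h1 (not_lt.mpr h2)
  · by_cases hjk : j = k
    · subst hjk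
      simpa [State.setPoly, State.goto] using hp
    · simpa [State.setPoly, State.goto, hjk] using h.lab j hj1 hj2
  · intro j
    rw [hA]
    exact h.mem_curr_or j
  · simpa only [hA] using h.disjoint

/-- The new signature by itself handles the pair it came from, even before the polynomial has been
reduced. -/
theorem append (h : IterInv m I f S A Q) {s : Sig n} {p : MvPolynomial (Fin n) K}
    (hs : s.2 = S.idx) (hsI : ¬ InLead m I s.1) (hp : Lab m I f s.1 p) {c : Ctrl n}
    (hA : ∀ k, k ∈ A' ↔ k = S.num + 1 ∨ k ∈ A)
    (hQ : ∀ c ∈ Q', c ∈ Q)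
    (hQ' : ∀ c ∈ Q, c ∈ Q' ∨ s = mulSig (S.mult m c.k c.l) (S.sig c.k)) :
    IterInv m I f (((S.append s p).addRule s (S.num + 1)).goto c) A' Q' := by
  have hsig : ∀ k, k ≤ S.num → Function.update S.sig (S.num + 1) s k = S.sig k := fun k hk =>
    Function.update_of_ne (by omega) _ _
  have hpoly : ∀ k, k ≤ S.num → Function.update S.poly (S.num + 1) p k = S.poly k := fun k hk =>
    Function.update_of_ne (by omega) _ _
  refine h.extend rfl rfl rfl rfl h.zero (Nat.le_succ _) hsig
    (fun j hj => hpoly j (h.le_num hj)) (fun j hj => ?_) ?_ (fun j hj1 hj2 => ?_)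
    (fun j hj1 hj2 => ?_) (fun j => ?_) (fun j hj => ?_) hQ (fun c hc => (hQ' c hc).imp_right ?_)
  · exact Function.update_of_ne (by omega) _ _
  · change Function.update S.rules s.2 (S.rules s.2 ++ [(s.1, S.num + 1)]) S.idx =
      (List.range' (S.idx + 1) (S.num + 1 - S.idx)).map
        fun k => ((Function.update S.sig (S.num + 1) s k).1, k)
    have hle := h.idx_le
    rw [hs, Function.update_self, h.rules, Nat.succ_sub hle, List.range'_1_concat, List.map_append]
    congr 1
    · refine List.map_congr_left fun j hj => ?_
      rw [List.mem_range'_1] at hj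
      rw [hsig j (by omega)]
    · rw [show S.idx + 1 + (S.num - S.idx) = S.num + 1 by omega]
      simp
  · change j ≤ S.num + 1 at hj2
    obtain rfl : j = S.num + 1 := by omega
    change (Function.update S.sig _ s _).2 = _ ∧ ¬ InLead m I (Function.update S.sig _ s _).1
    rw [Function.update_self]
    exact ⟨hs, hsI⟩
  · change Lab m I f (Function.update S.sig _ s j).1 (Function.update S.poly _ p j)
    rcases eq_or_ne j (S.num + 1) with rfl | hne
    · rwa [Function.update_self, Function.update_self]
    · have : j ≤ S.num := Nat.le_of_lt_succ (lt_of_le_of_ne hj2 hne)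
      rw [hsig j this, hpoly j this]
      exact h.lab j hj1 this
  · change j ∈ S.curr ∨ j ∈ A' ↔ 1 ≤ j ∧ j ≤ S.num + 1
    have := h.mem_curr_or j
    rw [hA]
    constructor
    · rintro (h1 | h1 | h1)
      · have := this.mp (Or.inl h1)
        omega
      · omega
      · have := this.mp (Or.inr h1)
        omega
    · intro h1
      by_cases h2 : j = S.num + 1
      · exact Or.inr (Or.inl h2)
      · exact (this.mpr (by omega)).imp_right Or.inr
  · rw [hA]
    rintro (h1 | h1)
    · have := h.le_num hj
      omega
    · exact h.disjoint j hj h1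
  · intro he
    have hv := h.valid c hc
    have hk := h.le_num hv.k_mem
    refine Or.inl ⟨S.num + 1, by omega, le_rfl, ?_⟩
    rw [mult_congr (S := S) (hpoly _ hk) (hpoly _ (h.le_num hv.l_mem))]
    change (Function.update S.sig _ s _).1 ≤ _ + (Function.update S.sig _ s _).1
    rw [Function.update_self, hsig _ hk, he]
    exact le_rfl

end IterInv

end Invariants

end F5C

/-! ### Critical pairs, and the Gröbner property at the end of an iteration -/

namespace F5C

section Iteration

variable {n : ℕ} {K : Type*} [Field K] {m : MonomialOrder (Fin n)}
  {I : Ideal (MvPolynomial (Fin n) K)}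
  {f : MvPolynomial (Fin n) K} {S S' : State n K} {A A' : Finset ℕ} {Q Q' : Set (CPair n)}

theorem PrevInv.validPair_of_mem_critPair (h : PrevInv m I S) {a b : ℕ} (ha : a ∈ S.curr)
    (hb : b ∈ S.curr) (hab : a ≠ b) (hia : S.idx ≤ a) (hsa : (S.sig a).2 = S.idx)
    (hsb : S.idx ≤ b ∧ (S.sig b).2 = S.idx ∨ (S.sig b).2 < S.idx) {c : CPair n}
    (hc : c ∈ S.critPair m a b) : ValidPair m I S c := by
  obtain ⟨hra, hrb, ⟨hlt, rfl⟩ | ⟨hlt, rfl⟩⟩ := hc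
  · rcases hsb with ⟨hib, hsb⟩ | hsb
    · exact ⟨hb, ha, hab.symm, hib, rfl, rfl,
        fun hl => hrb ⟨hsb, h.topRedByPrev_iff.mpr hl⟩, hlt.asymm⟩
    -- An element of the previous basis has a smaller signature index, so it is never the larger
    -- component.
    · rcases hlt with hlt | ⟨hlt, -⟩
      · change (S.sig a).2 < (S.sig b).2 at hlt
        omega
      · change (S.sig a).2 = (S.sig b).2 at hlt
        omega
  · exact ⟨ha, hb, hab, hia, rfl, rfl,
      fun hl => hra ⟨hsa, h.topRedByPrev_iff.mpr hl⟩, hlt⟩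

/-- Both orders of the arguments give the same pair, so it does not matter which of the two indices
entered `curr` later. -/
theorem mem_critPair_of_sigLT {k l : ℕ} (hk : ¬ S.Rejected m (S.mult m k l) k)
    (hl : ¬ S.Rejected m (S.mult m l k) l)
    (hlt : SigLT m (mulSig (S.mult m l k) (S.sig l)) (mulSig (S.mult m k l) (S.sig k))) :
    (⟨m.degree (S.poly k) ⊔ m.degree (S.poly l), k, S.mult m k l, l, S.mult m l k⟩ : CPair n) ∈
        S.critPair m k l ∧
      (⟨m.degree (S.poly k) ⊔ m.degree (S.poly l), k, S.mult m k l, l, S.mult m l k⟩ : CPair n) ∈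
        S.critPair m l k :=
  ⟨⟨hk, hl, Or.inr ⟨hlt.asymm, rfl⟩⟩, hl, hk, Or.inl ⟨hlt, by rw [sup_comm]⟩⟩

theorem PrevInv.not_rejected (h : PrevInv m I S) {u : Mon n} {k : ℕ}
    (hk : (S.sig k).2 = S.idx → ¬ InLead m I (u + (S.sig k).1)) : ¬ S.Rejected m u k :=
  fun hr => hk hr.1 (h.topRedByPrev_iff.mp hr.2)

theorem IterInv.sig_snd_cases (h : IterInv m I f S A Q) {k : ℕ} (h1 : 1 ≤ k) (h2 : k ≤ S.num) :
    S.idx ≤ k ∧ (S.sig k).2 = S.idx ∨ (S.sig k).2 < S.idx := by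
  rcases le_or_gt S.idx k with hk | hk
  · exact Or.inl ⟨hk, h.sig_snd' hk h2⟩
  · right
    rw [h.prevInv.sig k ((h.mem_prev k).mpr ⟨h1, hk⟩)]
    exact hk

theorem IterInv.collect (h : IterInv m I f S A Q) {k : ℕ} (hk : k ∈ A) {c : Ctrl n}
    {P : Set (CPair n)} (hA : ∀ j, j ∈ A' ↔ j ∈ A ∧ j ≠ k) (hQ : ∀ c, c ∈ Q' ↔ c ∈ Q ∨
      c ∈ ⋃ j ∈ S.curr, S.critPair m k j) :
    IterInv m I f { S with pairs := P, curr := insert k S.curr, ctrl := c } A' Q' := by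
  have hidx := h.idx_lt_of_mem hk
  obtain ⟨hk1, hkn⟩ := (h.mem_curr_or k).mp (Or.inr hk)
  refine
    { prevInv := h.prevInv.congr rfl rfl (fun _ _ => rfl) (fun _ _ => rfl) fun _ _ => rfl
      mem_prev := h.mem_prev
      one_le_idx := h.one_le_idx
      idx_le := h.idx_le
      sig_idx := h.sig_idx
      lab_idx := h.lab_idx
      poly_idx := h.poly_idx
      sig_snd := h.sig_snd
      lab := h.lab
      notInLead := h.notInLead
      rules := h.rules
      mem_curr_or := fun j => ?_
      disjoint := fun j hj => ?_
      mem_curr := fun j h1 h2 => Finset.mem_insert_of_mem (h.mem_curr j h1 h2)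
      zero := h.zero
      valid := fun c hc => ?_
      cover := fun i hi l hl h1 h2 h3 h4 => ?_ }
  · refine Iff.trans ?_ (h.mem_curr_or j)
    rw [hA, Finset.mem_insert]
    by_cases hjk : j = k
    · subst hjk
      simp [hk]
    · simp [hjk]
  · rw [hA]
    rintro ⟨hj1, hj2⟩
    rcases Finset.mem_insert.mp hj with hj | hj
    · exact hj2 hj
    · exact h.disjoint j hj hj1
  · rcases (hQ c).mp hc with hc | hc
    · have hv := h.valid c hc
      exact ⟨Finset.mem_insert_of_mem hv.k_mem, Finset.mem_insert_of_mem hv.l_mem, hv.ne,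
        hv.idx_le, hv.u_eq, hv.v_eq, hv.notInLead, hv.not_lt⟩
    · simp only [Set.mem_iUnion] at hc
      obtain ⟨j, hj, hc⟩ := hc
      have hjn := (h.mem_curr_or j).mp (Or.inl hj)
      refine (h.prevInv.congr (S' := { S with pairs := P, curr := insert k S.curr, ctrl := _ })
        rfl rfl (fun _ _ => rfl) (fun _ _ => rfl) fun _ _ => rfl).validPair_of_mem_critPair
        (Finset.mem_insert_self _ _) (Finset.mem_insert_of_mem hj) ?_ hidx.le (h.sig_snd k hidx hkn)
        (h.sig_snd_cases hjn.1 hjn.2) hc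
      rintro rfl
      exact h.disjoint _ hj hk
  · have hi' : i = k ∨ i ∈ S.curr := Finset.mem_insert.mp hi
    have hl' : l = k ∨ l ∈ S.curr := Finset.mem_insert.mp hl
    have hmem : i ∈ S.curr ∧ l ∈ S.curr ∨ _ ∈ S.critPair m i l ∧ _ ∈ S.critPair m l i :=
      Or.inr (mem_critPair_of_sigLT (h.prevInv.not_rejected fun _ => h3)
        (h.prevInv.not_rejected fun hs => h4 (by
          rcases hl' with rfl | hl'
          · exact hidx.le
          · by_contra hlt
            have := h.prevInv.sig l (h.mem_prev_of_lt hl' (not_le.mp hlt))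
            rw [this] at hs
            exact hlt hs.ge)) h2)
    rcases hi' with rfl | hi'
    · rcases hl' with rfl | hl'
      · exact absurd h2 (SigLT.irrefl _)
      · left
        rw [hQ]
        right
        simp only [Set.mem_iUnion]
        rcases hmem with hmem | hmem
        · exact absurd hk (h.disjoint _ hmem.1)
        · exact ⟨l, hl', hmem.1⟩
    · rcases hl' with rfl | hl'
      · left
        rw [hQ]
        right
        simp only [Set.mem_iUnion]
        rcases hmem with hmem | hmem
        · exact absurd hk (h.disjoint _ hmem.2)
        · exact ⟨i, hi', hmem.2⟩
      · rcases h.cover i hi' l hl' h1 h2 h3 h4 with h5 | h5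
        · exact Or.inl ((hQ _).mpr (Or.inl h5))
        · exact Or.inr h5

/-- The start of an iteration. -/
theorem IterInv.enter (h : PrevInv m I S) (hprev : ∀ j, j ∈ S.prev ↔ 1 ≤ j ∧ j ≤ S.num)
    (hzero : S.zeroReductions = 0) (hf : f ≠ 0) (rest : List (MvPolynomial (Fin n) K))
    {P : Set (CPair n)} :
    IterInv m I f { S.enter m f rest with pairs := P } ∅
      (⋃ j ∈ S.prev, (S.enter m f rest).critPair m (S.num + 1) j) := by
  have hsig : ∀ k, k ≤ S.num → (S.enter m f rest).sig k = S.sig k := fun k hk =>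
    Function.update_of_ne (by omega) _ _
  have hpoly : ∀ k, k ≤ S.num → (S.enter m f rest).poly k = S.poly k := fun k hk =>
    Function.update_of_ne (by omega) _ _
  have hsigN : (S.enter m f rest).sig (S.num + 1) = (0, S.num + 1) := Function.update_self _ _ _
  have hpolyN : (S.enter m f rest).poly (S.num + 1) = makeMonic m f := Function.update_self _ _ _
  have hrules : ∀ k, k ≤ S.num → (S.enter m f rest).rules k = S.rules k := fun k hk =>
    Function.update_of_ne (by omega) _ _
  have hle : ∀ j ∈ S.prev, j ≤ S.num := fun j hj => ((hprev j).mp hj).2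
  have hc : (m.leadingCoeff f)⁻¹ ≠ 0 := inv_ne_zero (m.leadingCoeff_ne_zero_iff.mpr hf)
  have hP : PrevInv m I (S.enter m f rest) := h.congr rfl rfl (fun j hj => hsig j (hle j hj))
    (fun j hj => hpoly j (hle j hj)) fun j hj => hrules j (hle j hj)
  refine
    { prevInv := hP.congr rfl rfl (fun _ _ => rfl) (fun _ _ => rfl) fun _ _ => rfl
      mem_prev := fun j => (hprev j).trans (and_congr_right fun _ => Nat.lt_succ_iff.symm)
      one_le_idx := Nat.succ_pos _
      idx_le := le_rfl
      sig_idx := hsigN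
      lab_idx := ?_
      poly_idx := ?_
      sig_snd := fun k h1 h2 => absurd h1 (not_lt.mpr h2)
      lab := fun k h1 h2 => absurd h1 (not_lt.mpr h2)
      notInLead := fun k h1 h2 => absurd h1 (not_lt.mpr h2)
      rules := ?_
      mem_curr_or := fun j => ?_
      disjoint := fun j _ => Finset.notMem_empty j
      mem_curr := fun j h1 h2 => ?_
      zero := hzero
      valid := fun c hc => ?_
      cover := fun i hi l hl h1 h2 h3 h4 => ?_ }
  · refine ⟨MvPolynomial.C (m.leadingCoeff f)⁻¹, by simpa using hf, m.degree_C _, ?_⟩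
    change (S.enter m f rest).poly (S.num + 1) - _ ∈ I
    rw [hpolyN, makeMonic, sub_self]
    exact I.zero_mem
  · change (S.enter m f rest).poly (S.num + 1) ≠ 0
    rw [hpolyN, makeMonic]
    exact mul_ne_zero (by simpa using hf) hf
  · change Function.update S.rules (S.num + 1) [] (S.num + 1) =
      (List.range' _ (S.num + 1 - (S.num + 1))).map _
    simp
  · change j ∈ insert (S.num + 1) S.prev ∨ j ∈ ∅ ↔ 1 ≤ j ∧ j ≤ S.num + 1
    rw [Finset.mem_insert, hprev]
    simp only [Finset.notMem_empty, or_false]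
    omega
  · change j ≤ S.num + 1 at h2
    change j ∈ insert (S.num + 1) S.prev
    rw [Finset.mem_insert, hprev]
    omega
  · simp only [Set.mem_iUnion] at hc
    obtain ⟨j, hj, hc⟩ := hc
    have hjn := hle j hj
    have hv : ValidPair m I (S.enter m f rest) c :=
      hP.validPair_of_mem_critPair (Finset.mem_insert_self _ _) (Finset.mem_insert_of_mem hj)
        (by omega) le_rfl (by rw [hsigN]; rfl) (Or.inr (by
          rw [hsig j hjn, h.sig j hj]
          exact Nat.lt_succ_of_le hjn)) hc
    exact ⟨hv.k_mem, hv.l_mem, hv.ne, hv.idx_le, hv.u_eq, hv.v_eq, hv.notInLead, hv.not_lt⟩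
  · have hi' : i = S.num + 1 ∨ i ∈ S.prev := Finset.mem_insert.mp hi
    have hl' : l = S.num + 1 ∨ l ∈ S.prev := Finset.mem_insert.mp hl
    change S.num + 1 ≤ i at h1
    obtain rfl : i = S.num + 1 := hi'.resolve_right fun hi' => by
      have := hle i hi'
      omega
    rcases hl' with rfl | hl'
    · exact absurd h2 (SigLT.irrefl _)
    · left
      simp only [Set.mem_iUnion]
      refine ⟨l, hl', (mem_critPair_of_sigLT (hP.not_rejected fun _ => h3)
        (hP.not_rejected fun hs => ?_) h2).1⟩
      rw [hP.sig l hl'] at hs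
      have := hle l hl'
      change l = S.num + 1 at hs
      omega

/-- When no critical pair is left, the current polynomials form a Gröbner basis of `I + (f)`. -/
theorem IterInv.groebner (hnzd : ∀ h, h * f ∈ I → h ∈ I) (h : IterInv m I f S ∅ ∅)
    {p a : MvPolynomial (Fin n) K} (hp : p - a * f ∈ I) (hp0 : p ≠ 0) :
    ∃ k ∈ S.curr, m.degree (S.poly k) ≤ m.degree p := by
  have hcurr : ∀ k, k ∈ S.curr ↔ 1 ≤ k ∧ k ≤ S.num := by simpa using h.mem_curr_or
  have hmult : ∀ {k l : ℕ} {w t : Mon n}, w + m.degree (S.poly k) = t → m.degree (S.poly l) ≤ t →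
      S.mult m k l ≤ w := by
    intro k l w t hk hl
    rw [State.mult, tsub_le_iff_right, hk]
    exact sup_le (hk ▸ le_add_self) hl
  have hT : ∃ k ∈ Finset.Icc S.idx S.num, (S.sig k).1 = 0 :=
    ⟨S.idx, Finset.mem_Icc.mpr ⟨le_rfl, h.idx_le⟩, by rw [h.sig_idx]⟩
  have hlab : ∀ k ∈ Finset.Icc S.idx S.num, Lab m I f (S.sig k).1 (S.poly k) := fun k hk =>
    h.lab' (Finset.mem_Icc.mp hk).1 (Finset.mem_Icc.mp hk).2
  have hpoly : ∀ k ∈ Finset.Icc S.idx S.num, S.poly k ≠ 0 := fun k hk =>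
    h.poly_ne_zero hnzd (h.one_le_idx.trans (Finset.mem_Icc.mp hk).1) (Finset.mem_Icc.mp hk).2
  have hlast : ∀ {σ : Mon n} {k : ℕ} {w : Mon n},
      IsLastDivisor (Finset.Icc S.idx S.num) (fun k => (S.sig k).1) σ k → w ≤ σ - (S.sig k).1 →
      w + (S.sig k).1 ≤ σ ∧ ∀ j, k < j → j ≤ S.num → ¬ (S.sig j).1 ≤ w + (S.sig k).1 := by
    intro σ k w hk hw
    have hle := (le_tsub_iff_right hk.2.1).mp hw
    refine ⟨hle, fun j hj1 hj2 hj3 => hk.2.2 j ?_ hj1 (hj3.trans hle)⟩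
    exact Finset.mem_Icc.mpr ⟨(Finset.mem_Icc.mp hk.1).1.trans hj1.le, hj2⟩
  -- In both remaining goals a coincidence or divisibility of head monomials is shrunk to the
  -- critical pair of the two indices. No pair is pending, so `cover` says that this one is handled.
  have hmin := lastDivisorMinimal hT hlab hpoly
    (fun σ hσ k hk hlead => ?_) (fun σ hσ k hk τ hτσ hτ l hl ht => ?_)
  · rcases inLead_or_exists_degree_le hT hlab hpoly hmin hp hp0 with hlead | ⟨l, hl, hd⟩
    · obtain ⟨j, hj, hd⟩ := h.prevInv.topRedByPrev_iff.mpr hlead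
      exact ⟨j, h.prev_subset hj, hd⟩
    · have hl' := Finset.mem_Icc.mp hl
      exact ⟨l, (hcurr l).mpr ⟨h.one_le_idx.trans hl'.1, hl'.2⟩, hd⟩
  · classical
    have hk' := Finset.mem_Icc.mp hk.1
    have hex : ∃ l, l ∈ S.prev ∧ m.degree (S.poly l) ≤ σ - (S.sig k).1 + m.degree (S.poly k) :=
      h.prevInv.topRedByPrev_iff.mpr hlead
    -- The least previous index is taken because a rule of a previous index would produce a smaller
    -- one with the same property.
    obtain ⟨hl, hd⟩ := Nat.find_spec hex
    set l := Nat.find hex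
    have hlidx := ((h.mem_prev l).mp hl).2
    obtain ⟨hle, hno⟩ := hlast hk (hmult rfl hd)
    rcases h.cover k ((hcurr k).mpr ⟨h.one_le_idx.trans hk'.1, hk'.2⟩) l (h.prev_subset hl) hk'.1
      (Or.inl (by
        change (S.sig l).2 < (S.sig k).2
        rw [h.prevInv.sig l hl, h.sig_snd' hk'.1 hk'.2]
        exact hlidx)) (fun hh => hσ (hh.mono hle)) (fun hh => absurd hlidx (not_lt.mpr hh)) with
      h1 | ⟨j, h1, h2, h3⟩ | ⟨h0, -⟩ | ⟨-, j, h1, h2, h3⟩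
    · exact h1
    · exact hno j h1 h2 h3
    · exact absurd hlidx (not_lt.mpr h0)
    · refine Nat.find_min hex h2 ⟨h1, h3.trans ?_⟩
      rw [State.mult, tsub_add_cancel_of_le le_sup_left]
      exact sup_le hd le_add_self
  · have hk' := Finset.mem_Icc.mp hk.1
    have hl' := Finset.mem_Icc.mp hl.1
    have hul := hmult rfl (ht.le.trans' (le_add_self (a := m.degree (S.poly l))))
    have hvl := hmult (k := l) (l := k) rfl (ht.ge.trans' le_add_self)
    obtain ⟨hle, hno⟩ := hlast hk hul
    obtain ⟨hle', hno'⟩ := hlast hl hvl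
    have hkm : S.mult m k l + m.degree (S.poly k) = S.mult m l k + m.degree (S.poly l) := by
      rw [State.mult, State.mult, tsub_add_cancel_of_le le_sup_left,
        tsub_add_cancel_of_le le_sup_left, sup_comm]
    have hlt : S.mult m l k + (S.sig l).1 ≺[m] S.mult m k l + (S.sig k).1 := by
      -- Both multipliers exceed those of the critical pair by the same monomial; cancelling it from
      -- τ ≺ σ orders the components of the pair.
      obtain ⟨w, hw⟩ := exists_add_of_le hul
      obtain ⟨w', hw'⟩ := exists_add_of_le hvl
      have hww : w' = w := by
        rw [hw, hw', add_right_comm, add_right_comm (S.mult m k l), hkm] at ht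
        exact add_left_cancel ht
      have h1 := tsub_add_cancel_of_le hk.2.1
      have h2 := tsub_add_cancel_of_le hl.2.1
      simp only at h1 h2
      rw [← h1, ← h2, hw, hw', hww, add_right_comm, add_right_comm (S.mult m k l)] at hτσ
      simpa using hτσ
    -- A handled pair gives a later signature dividing one of the components, hence dividing σ or τ,
    -- against the choice of k and l as last divisors.
    rcases h.cover k ((hcurr k).mpr ⟨h.one_le_idx.trans hk'.1, hk'.2⟩) l
      ((hcurr l).mpr ⟨h.one_le_idx.trans hl'.1, hl'.2⟩) hk'.1
      (Or.inr ⟨(h.sig_snd' hl'.1 hl'.2).trans (h.sig_snd' hk'.1 hk'.2).symm, hlt⟩)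
      (fun hh => hσ (hh.mono hle)) (fun _ hh => hτ (hh.mono hle')) with
      h1 | ⟨j, h1, h2, h3⟩ | ⟨-, j, h1, h2, h3⟩ | ⟨h0, -⟩
    · exact h1
    · exact hno j h1 h2 h3
    · exact hno' j h1 h2 h3
    · exact absurd ((h.mem_prev l).mp h0).2 (not_lt.mpr hl'.1)

end Iteration

/-! ### Normal forms, interreduction and the reset between iterations -/

section Interreduction

variable {n : ℕ} {K : Type*} [Field K] {m : MonomialOrder (Fin n)}
  {J : Ideal (MvPolynomial (Fin n) K)}

/-- `L` is a list of elements of `J` whose head monomials generate those of `J`. -/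
def IsGroebnerList (m : MonomialOrder (Fin n)) (J : Ideal (MvPolynomial (Fin n) K))
    (L : List (MvPolynomial (Fin n) K)) : Prop :=
  (∀ p ∈ L, p ∈ J) ∧ ∀ g ∈ J, g ≠ 0 → ∃ b ∈ L, b ≠ 0 ∧ m.degree b ≤ m.degree g

theorem RedStep.sub_mem {B : List (MvPolynomial (Fin n) K)} (hB : ∀ b ∈ B, b ∈ J)
    {p p' : MvPolynomial (Fin n) K} (h : RedStep m B p p') : p' - p ∈ J := by
  obtain ⟨q, hq, t, -, -, -, rfl⟩ := h
  rw [sub_sub_cancel_left]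
  exact J.neg_mem (J.mul_mem_left _ (hB q hq))

theorem IsNormalForm.sub_mem {B : List (MvPolynomial (Fin n) K)} (hB : ∀ b ∈ B, b ∈ J)
    {p p' : MvPolynomial (Fin n) K} (h : IsNormalForm m B p p') : p' - p ∈ J := by
  obtain ⟨h, -⟩ := h
  induction h with
  | refl => simp
  | tail _ h2 ih => simpa using J.add_mem (h2.sub_mem hB) ih

theorem degree_makeMonic {p : MvPolynomial (Fin n) K} (hp : p ≠ 0) :
    makeMonic m p ≠ 0 ∧ m.degree (makeMonic m p) = m.degree p := by
  have hc : (m.leadingCoeff p)⁻¹ ≠ 0 := inv_ne_zero (m.leadingCoeff_ne_zero_iff.mpr hp)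
  have hc' : (MvPolynomial.C (m.leadingCoeff p)⁻¹ : MvPolynomial (Fin n) K) ≠ 0 := by simpa using hp
  refine ⟨mul_ne_zero hc' hp, ?_⟩
  rw [makeMonic, m.degree_mul hc' hp, m.degree_C, zero_add]

/-- Only cancelling the head term of an element can lose a head monomial, and then the head monomial
of the reducer, which stays in the list, divides it. -/
theorem InterredStep.isGroebnerList {P B : List (MvPolynomial (Fin n) K)}
    (h : InterredStep m P B) (hP : IsGroebnerList m J P) : IsGroebnerList m J B := by
  obtain ⟨hmem, hgb⟩ := hP
  cases h with
  | reduce p p' L h =>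
    have hL : ∀ q ∈ L, q ∈ J := fun q hq => hmem q (List.mem_cons_of_mem _ hq)
    refine ⟨fun q hq => ?_, fun g hg hg0 => ?_⟩
    · rcases List.mem_cons.mp hq with rfl | hq
      · simpa using J.add_mem (h.sub_mem hL) (hmem p List.mem_cons_self)
      · exact hL q hq
    · obtain ⟨b, hb, hb0, hd⟩ := hgb g hg hg0
      rcases List.mem_cons.mp hb with rfl | hb
      · obtain ⟨q, hq, t, hq0, ht, hqt, rfl⟩ := h
        have hle := m.le_degree ht
        rcases hle.eq_or_lt with he | hlt
        · rw [m.toSyn.injective he] at hqt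
          exact ⟨q, List.mem_cons_of_mem _ hq, hq0, hqt.trans hd⟩
        · have hlt' : m.degree (MvPolynomial.monomial (t - m.degree q)
              (b.coeff t * (m.leadingCoeff q)⁻¹) * q) ≺[m] m.degree b := by
            rwa [degree_monomial_mul (mul_ne_zero (MvPolynomial.mem_support_iff.mp ht)
              (inv_ne_zero (m.leadingCoeff_ne_zero_iff.mpr hq0))) hq0, tsub_add_cancel_of_le hqt]
          exact ⟨_, List.mem_cons_self, sub_ne_zero_of_degree_lt hlt',
            (m.degree_sub_of_lt hlt').trans_le hd⟩
      · exact ⟨b, List.mem_cons_of_mem _ hb, hb0, hd⟩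
  | drop L =>
    refine ⟨fun q hq => hmem q (List.mem_cons_of_mem _ hq), fun g hg hg0 => ?_⟩
    obtain ⟨b, hb, hb0, hd⟩ := hgb g hg hg0
    rcases List.mem_cons.mp hb with rfl | hb
    · exact absurd rfl hb0
    · exact ⟨b, hb, hb0, hd⟩
  | scale p L =>
    refine ⟨fun q hq => ?_, fun g hg hg0 => ?_⟩
    · rcases List.mem_cons.mp hq with rfl | hq
      · exact J.mul_mem_left _ (hmem p List.mem_cons_self)
      · exact hmem q (List.mem_cons_of_mem _ hq)
    · obtain ⟨b, hb, hb0, hd⟩ := hgb g hg hg0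
      rcases List.mem_cons.mp hb with rfl | hb
      · exact ⟨_, List.mem_cons_self, (degree_makeMonic hb0).1, (degree_makeMonic hb0).2.trans_le hd⟩
      · exact ⟨b, List.mem_cons_of_mem _ hb, hb0, hd⟩
  | perm L L' h =>
    refine ⟨fun q hq => hmem q (h.mem_iff.mpr hq), fun g hg hg0 => ?_⟩
    obtain ⟨b, hb, hb'⟩ := hgb g hg hg0
    exact ⟨b, h.mem_iff.mp hb, hb'⟩

theorem IsInterreduction.isGroebnerList {P B : List (MvPolynomial (Fin n) K)}
    (h : IsInterreduction m P B) (hP : IsGroebnerList m J P) : IsGroebnerList m J B := by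
  obtain ⟨h, -⟩ := h
  induction h with
  | refl => exact hP
  | tail _ h2 ih => exact h2.isGroebnerList ih

theorem PrevInv.setup (S : State n K) {B : List (MvPolynomial (Fin n) K)}
    (hB : IsGroebnerList m J B) (hmonic : ∀ b ∈ B, m.leadingCoeff b = 1) :
    PrevInv m J (S.setup m B) := by
  have hne : ∀ b ∈ B, b ≠ 0 := fun b hb => by
    rw [← m.leadingCoeff_ne_zero_iff, hmonic b hb]
    exact one_ne_zero
  -- List positions start at 0, indices of labeled polynomials at 1.
  have hpoly : ∀ i (hi : i < B.length), (S.setup m B).poly (i + 1) = B[i] := fun i hi => by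
    simp [State.setup, List.getElem?_eq_getElem hi]
  have hprev : ∀ j ∈ (S.setup m B).prev, ∃ i, ∃ hi : i < B.length, j = i + 1 := fun j hj => by
    have := Finset.mem_Icc.mp hj
    exact ⟨j - 1, by omega, by omega⟩
  have hprev' : ∀ i < B.length, i + 1 ∈ (S.setup m B).prev := fun i hi =>
    Finset.mem_Icc.mpr ⟨by omega, hi⟩
  refine
    { mem := fun j hj => ?_
      ne_zero := fun j hj => ?_
      groebner := fun g hg hg0 => ?_
      sig := fun _ _ => rfl
      mem_B := hB.1
      degree_B := fun j hj => ?_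
      rules := fun l hl ρ hρ => ?_ }
  · obtain ⟨i, hi, rfl⟩ := hprev j hj
    rw [hpoly i hi]
    exact hB.1 _ (List.getElem_mem hi)
  · obtain ⟨i, hi, rfl⟩ := hprev j hj
    rw [hpoly i hi]
    exact hne _ (List.getElem_mem hi)
  · obtain ⟨b, hb, -, hd⟩ := hB.2 g hg hg0
    obtain ⟨i, hi, rfl⟩ := List.getElem_of_mem hb
    exact ⟨i + 1, hprev' i hi, by rwa [hpoly i hi]⟩
  · obtain ⟨i, hi, rfl⟩ := hprev j hj
    exact ⟨B[i], List.getElem_mem hi, hne _ (List.getElem_mem hi), by rw [hpoly i hi]⟩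
  · obtain ⟨i, hi, rfl⟩ := hprev l hl
    have hr : (S.setup m B).rules (i + 1) = (B.take i).map fun b =>
        ((m.degree b ⊔ m.degree B[i]) - m.degree B[i], 0) := by
      simp [State.setup, List.getElem?_eq_getElem hi, Nat.succ_le_of_lt hi]
    rw [hr, List.mem_map] at hρ
    obtain ⟨b, hb, rfl⟩ := hρ
    obtain ⟨j, hj, rfl⟩ := List.mem_take_iff_getElem.mp hb
    have hj' : j < i ∧ j < B.length := by omega
    exact ⟨j + 1, hprev' j hj'.2, by omega, by rw [hpoly i hi, hpoly j hj'.2]⟩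

end Interreduction

end F5C

/-! ### The invariant of whole runs -/

namespace F5C

section Runs

variable {n : ℕ} {K : Type*} [Field K] {m : MonomialOrder (Fin n)}

/-- The indices handled by the current subroutine that are not yet in `curr`. -/
def Ctrl.active : Ctrl n → Finset ℕ
  | .spols _ new => new
  | .reduction todo completed => todo ∪ completed
  | .topReduction k todo completed => insert k (todo ∪ completed)
  | .collect reduced => reduced
  | _ => ∅

/-- The critical pairs that have been selected but not yet considered. -/
def Ctrl.selected : Ctrl n → Set (CPair n)
  | .spols L _ => {c | c ∈ L}
  | _ => ∅

/-- The invariant of F5C for the sorted input `fs`. -/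
inductive Inv (m : MonomialOrder (Fin n)) (fs : List (MvPolynomial (Fin n) K))
    (S : State n K) : Prop
  | main (L : List (MvPolynomial (Fin n) K)) (hfs : fs = L ++ S.rest) (hc : S.ctrl = Ctrl.main)
      (h : PrevInv m (Ideal.span {p | p ∈ L}) S) (hprev : ∀ j, j ∈ S.prev ↔ 1 ≤ j ∧ j ≤ S.num)
      (hzero : S.zeroReductions = 0)
  | iteration (L : List (MvPolynomial (Fin n) K)) (f : MvPolynomial (Fin n) K)
      (hfs : fs = L ++ f :: S.rest) (hc : S.ctrl ≠ Ctrl.main)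
      (h : IterInv m (Ideal.span {p | p ∈ L}) f S S.ctrl.active (S.pairs ∪ S.ctrl.selected))
      (hirr : ∀ k todo completed, S.ctrl = Ctrl.topReduction k todo completed → S.poly k ≠ 0 →
        ∀ j ∈ S.prev, ¬ m.degree (S.poly j) ≤ m.degree (S.poly k))
  | done (hc : S.ctrl = Ctrl.done) (hzero : S.zeroReductions = 0)
      (hpoly : ∀ j, 1 ≤ j → j ≤ S.num → S.poly j ≠ 0)

variable {I : Ideal (MvPolynomial (Fin n) K)} {f : MvPolynomial (Fin n) K} {S S' : State n K}
  {A A' : Finset ℕ} {Q Q' : Set (CPair n)}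

theorem PrevInv.init (f : MvPolynomial (Fin n) K) (hf : f ≠ 0)
    (rest : List (MvPolynomial (Fin n) K)) :
    PrevInv m (Ideal.span {p | p ∈ [f]}) (initState m f rest) := by
  have hset : {p | p ∈ [f]} = {f} := by
    ext p
    simp
  rw [hset]
  have hp : (initState m f rest).poly 1 = makeMonic m f := rfl
  have hprev : ∀ j ∈ (initState m f rest).prev, j = 1 := fun j hj => Finset.mem_singleton.mp hj
  refine
    { mem := fun j hj => ?_
      ne_zero := fun j hj => ?_
      groebner := fun g hg hg0 => ⟨1, Finset.mem_singleton_self 1, ?_⟩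
      sig := fun _ _ => rfl
      mem_B := fun b hb => ?_
      degree_B := fun j hj => ?_
      rules := fun l _ ρ hρ => absurd hρ List.not_mem_nil }
  · rw [hprev j hj, hp]
    exact Ideal.mul_mem_left _ _ (Ideal.mem_span_singleton_self f)
  · rw [hprev j hj, hp]
    exact (degree_makeMonic hf).1
  · obtain ⟨a, rfl⟩ := Ideal.mem_span_singleton'.mp hg
    rw [hp, (degree_makeMonic hf).2, m.degree_mul (left_ne_zero_of_mul hg0) hf]
    exact le_add_self
  · rw [List.mem_singleton.mp hb]
    exact Ideal.mem_span_singleton_self f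
  · rw [hprev j hj, hp]
    exact ⟨f, List.mem_singleton_self f, hf, (degree_makeMonic hf).2.symm⟩

/-- The multiple of a reductor, and its label. -/
theorem IterInv.lab_reductor (h : IterInv m I f S A Q) {G : Finset ℕ} (hG : ∀ j ∈ G, j ≤ S.num)
    {k j : ℕ} (hirr : ∀ j ∈ S.prev, ¬ m.degree (S.poly j) ≤ m.degree (S.poly k))
    (hG' : ∀ j ∈ G, 1 ≤ j) (hJ : S.IsReductor m G k j) {c : K} (hc : c ≠ 0) :
    (S.sig j).2 = S.idx ∧ ¬ InLead m I (m.degree (S.poly k) - m.degree (S.poly j) + (S.sig j).1) ∧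
      Lab m I f (m.degree (S.poly k) - m.degree (S.poly j) + (S.sig j).1)
        (MvPolynomial.monomial (m.degree (S.poly k) - m.degree (S.poly j)) c * S.poly j) := by
  obtain ⟨hj, hd, -, -, ht⟩ := hJ
  -- A polynomial in normal form has no reductor in the previous basis, so the reductor carries the
  -- current signature index.
  have hidx : S.idx ≤ j := by
    by_contra hlt
    exact hirr j ((h.mem_prev j).mpr ⟨hG' j hj, not_le.mp hlt⟩) hd
  rw [h.prevInv.topRedByPrev_iff] at ht
  exact ⟨h.sig_snd' hidx (hG j hj), ht, (h.lab' hidx (hG j hj)).monomial_mul _ hc⟩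

theorem mem_span_append_singleton {L : List (MvPolynomial (Fin n) K)}
    {f p : MvPolynomial (Fin n) K} : p ∈ Ideal.span {p | p ∈ L ++ [f]} ↔
      ∃ h, p - h * f ∈ Ideal.span {p | p ∈ L} := by
  have hset : {p | p ∈ L ++ [f]} = insert f {p | p ∈ L} := by
    ext p
    simp [or_comm]
  rw [hset, Ideal.mem_span_insert]
  constructor
  · rintro ⟨a, z, hz, rfl⟩
    exact ⟨a, by simpa using hz⟩
  · rintro ⟨h, hh⟩
    exact ⟨h, _, hh, by ring⟩

/-- The two transitions that meet a zero polynomial are refuted by the labels. Correctness of the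
finished iteration is needed only for `setup`, where I is replaced by I + (f). -/
theorem Inv.step {fs : List (MvPolynomial (Fin n) K)} (hfs0 : ∀ f ∈ fs, f ≠ 0)
    (hnzd : ∀ L f rest, fs = L ++ f :: rest → ∀ h, h * f ∈ Ideal.span {p | p ∈ L} →
      h ∈ Ideal.span {p | p ∈ L}) (hS : Inv m fs S) (hstep : Step m S S') : Inv m fs S' := by
  cases hS with
  | done hc' hzero hpoly => cases hstep <;> simp_all
  | main L hfs hc' h hprev hzero =>
    cases hstep with
    | finish hc hr =>
      exact .done rfl hzero fun j h1 h2 => h.ne_zero j ((hprev j).mpr ⟨h1, h2⟩)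
    | enter f rest hc hr =>
      rw [hr] at hfs
      have := IterInv.enter (f := f) h hprev hzero (hfs0 f (by rw [hfs]; simp)) rest
        (P := ⋃ j ∈ S.prev, (S.enter m f rest).critPair m (S.num + 1) j)
      refine .iteration L f hfs (fun he => nomatch he) ?_ fun _ _ _ he => nomatch he
      exact this.of_eq rfl rfl rfl rfl rfl rfl rfl rfl rfl (fun _ => Iff.rfl)
        (fun _ hc => hc.resolve_right id) fun _ hc => Or.inl (Or.inl hc)
    | _ => simp_all
  | iteration L f hfs hm h hirr =>
    have hnz := hnzd L f S.rest hfs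
    have hne := fun j h1 h2 => h.poly_ne_zero hnz (k := j) h1 h2
    cases hstep with
    | finish hc => exact absurd hc hm
    | enter _ _ hc => exact absurd hc hm
    | select d P hc hd hP hnd hs =>
      rw [hc] at h
      refine .iteration L f hfs (fun he => nomatch he) ?_ fun _ _ _ he => nomatch he
      refine h.of_eq rfl rfl rfl rfl rfl rfl rfl rfl rfl (fun _ => Iff.rfl) ?_ ?_
      · rintro c (hc | hc)
        · exact Or.inl hc.1
        · exact Or.inl ((hP c).mp hc).1
      · rintro c (hc | hc)
        · left
          by_cases hcd : c.t.degree = d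
          · exact Or.inr ((hP c).mpr ⟨hc, hcd⟩)
          · exact Or.inl ⟨hc, hcd⟩
        · exact hc.elim
    | spolSkip c P new hc hw =>
      rw [hc] at h
      have hv := h.valid c (Or.inr List.mem_cons_self)
      refine .iteration L f hfs (fun he => nomatch he) ?_ fun _ _ _ he => nomatch he
      refine h.of_eq rfl rfl rfl rfl rfl rfl rfl rfl rfl (fun _ => Iff.rfl) ?_ ?_
      · exact fun _ => Or.imp_right (List.mem_cons_of_mem _)
      · rintro c' (hc' | hc')
        · exact Or.inl (Or.inl hc')
        · rcases List.mem_cons.mp hc' with rfl | hc'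
          · exact Or.inr (h.handled_of_rewritable hv hw)
          · exact Or.inl (Or.inr hc')
    | spolTake c P new hc hk hl h0 =>
      rw [hc] at h
      have hv := h.valid c (Or.inr List.mem_cons_self)
      refine .iteration L f hfs (fun he => nomatch he) ?_ fun _ _ _ he => nomatch he
      refine h.append (s := mulSig c.u (S.sig c.k)) (h.sig_snd' hv.idx_le (h.le_num hv.k_mem)) hv.notInLead
        (h.lab_sPolynomial hnz hv hk hl) (fun _ => Finset.mem_insert) ?_ ?_
      · exact fun _ => Or.imp_right (List.mem_cons_of_mem _)
      · rintro c' (hc' | hc')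
        · exact Or.inl (Or.inl hc')
        · rcases List.mem_cons.mp hc' with rfl | hc'
          · exact Or.inr (by rw [hv.u_eq])
          · exact Or.inl (Or.inr hc')
    | spolZero c P new hc hk hl h0 =>
      rw [hc] at h
      have hv := h.valid c (Or.inr List.mem_cons_self)
      -- A zero S-polynomial would carry a label outside the head ideal.
      exact absurd h0 ((h.lab_sPolynomial hnz hv hk hl).ne_zero hnz hv.notInLead)
    | spolsEnd new hc =>
      rw [hc] at h
      refine .iteration L f hfs (fun he => nomatch he) ?_ fun _ _ _ he => nomatch he
      refine h.of_eq rfl rfl rfl rfl rfl rfl rfl rfl rfl (fun k => ?_) ?_ ?_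
      · change k ∈ new ∪ ∅ ↔ k ∈ new
        rw [Finset.union_empty]
      · exact fun _ hc => Or.inl (hc.resolve_right id)
      · exact fun _ hc => Or.inl (Or.inl (hc.resolve_right List.not_mem_nil))
    | normalForm todo completed k p hc hk hmin hp =>
      rw [hc] at h
      have hkA : k ∈ todo ∪ completed := Finset.mem_union_left _ hk
      have hidx := h.idx_lt_of_mem hkA
      have hkn := ((h.mem_curr_or k).mp (Or.inr hkA)).2
      refine .iteration L f hfs (fun he => nomatch he) ?_ ?_
      · refine h.setPoly hkA ((h.lab k hidx hkn).congr (hp.sub_mem h.prevInv.mem_B)) fun j => ?_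
        change j ∈ insert k (todo.erase k ∪ completed) ↔ j ∈ todo ∪ completed
        simp only [Finset.mem_insert, Finset.mem_union, Finset.mem_erase]
        by_cases hjk : j = k
        · subst hjk
          simp [hk]
        · simp [hjk]
      · intro k' todo' completed' he h0 j hj hd
        obtain rfl : k = k' := by
          simp only [State.goto, Ctrl.topReduction.injEq] at he
          exact he.1
        have hjk : j ≠ k := by
          rintro rfl
          exact h.disjoint _ (h.prev_subset hj) hkA
        simp only [State.goto, State.setPoly, Function.update_self,
          Function.update_of_ne hjk] at h0 hd
        -- In the first iteration `B` holds the unscaled f₁ while `prev` indexes its monic multiple;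
        -- only the agreement of head monomials is used.
        obtain ⟨b, hb, hb0, hbd⟩ := h.prevInv.degree_B j hj
        exact hp.2 b hb hb0 _ (m.degree_mem_support h0) (hbd ▸ hd)
    | zero todo completed k hc h0 =>
      rw [hc] at h
      have hk := (h.mem_curr_or k).mp (Or.inr (Finset.mem_insert_self _ _))
      exact absurd h0 (hne k hk.1 hk.2)
    | complete todo completed k hc h0 hJ =>
      rw [hc] at h
      have hkA : k ∈ insert k (todo ∪ completed) := Finset.mem_insert_self _ _
      have hidx := h.idx_lt_of_mem hkA
      have hkn := ((h.mem_curr_or k).mp (Or.inr hkA)).2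
      refine .iteration L f hfs (fun he => nomatch he) ?_ fun _ _ _ he => nomatch he
      refine h.setPoly hkA ((h.lab k hidx hkn).makeMonic hnz (h.notInLead k hidx hkn)) fun j => ?_
      change j ∈ todo ∪ insert k completed ↔ j ∈ insert k (todo ∪ completed)
      rw [Finset.union_insert]
    | preserve todo completed k j hc h0 hJ hs =>
      have hirr' := hirr k todo completed hc h0
      rw [hc] at h
      have hkA : k ∈ insert k (todo ∪ completed) := Finset.mem_insert_self _ _
      have hidx := h.idx_lt_of_mem hkA
      have hkn := ((h.mem_curr_or k).mp (Or.inr hkA)).2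
      have hG : ∀ j ∈ S.curr ∪ completed, 1 ≤ j ∧ j ≤ S.num := fun j hj =>
        (h.mem_curr_or j).mp ((Finset.mem_union.mp hj).imp_right fun hj =>
          Finset.mem_insert_of_mem (Finset.mem_union_right _ hj))
      have hj0 := hne j (hG j hJ.1).1 (hG j hJ.1).2
      obtain ⟨hsj, hlead, hlab⟩ := h.lab_reductor (fun j hj => (hG j hj).2) hirr'
        (fun j hj => (hG j hj).1) hJ (mul_ne_zero (m.leadingCoeff_ne_zero_iff.mpr h0)
          (inv_ne_zero (m.leadingCoeff_ne_zero_iff.mpr hj0)))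
      have hlt := hs.resolve_left fun hlt => by
        change (S.sig j).2 < (S.sig k).2 at hlt
        rw [hsj, h.sig_snd k hidx hkn] at hlt
        exact lt_irrefl _ hlt
      refine .iteration L f hfs (fun he => nomatch he) ?_ fun _ _ _ he => nomatch he
      refine h.setPoly hkA (((h.lab k hidx hkn).sub hlab hlt.2).makeMonic hnz
        (h.notInLead k hidx hkn)) fun i => ?_
      change i ∈ insert k todo ∪ completed ↔ i ∈ insert k (todo ∪ completed)
      rw [Finset.insert_union]
    | newLabel todo completed k j hc h0 hJ hs =>
      have hirr' := hirr k todo completed hc h0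
      rw [hc] at h
      have hkA : k ∈ insert k (todo ∪ completed) := Finset.mem_insert_self _ _
      have hidx := h.idx_lt_of_mem hkA
      have hkn := ((h.mem_curr_or k).mp (Or.inr hkA)).2
      have hG : ∀ j ∈ S.curr ∪ completed, 1 ≤ j ∧ j ≤ S.num := fun j hj =>
        (h.mem_curr_or j).mp ((Finset.mem_union.mp hj).imp_right fun hj =>
          Finset.mem_insert_of_mem (Finset.mem_union_right _ hj))
      have hj0 := hne j (hG j hJ.1).1 (hG j hJ.1).2
      obtain ⟨hsj, hlead, hlab⟩ := h.lab_reductor (fun j hj => (hG j hj).2) hirr'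
        (fun j hj => (hG j hj).1) hJ (mul_ne_zero (m.leadingCoeff_ne_zero_iff.mpr h0)
          (inv_ne_zero (m.leadingCoeff_ne_zero_iff.mpr hj0)))
      -- A reductor never has an equal signature, so failure of ≺ means that the reductor's label is
      -- strictly larger and survives the subtraction.
      have hlt := SigLT.of_not hs hJ.2.2.1.symm (hsj.trans (h.sig_snd k hidx hkn).symm)
      refine .iteration L f hfs (fun he => nomatch he) ?_ fun _ _ _ he => nomatch he
      refine h.append (s := mulSig _ (S.sig j)) hsj hlead (((h.lab k hidx hkn).sub' hlab hlt).makeMonic hnz hlead)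
        (fun i => ?_) (fun _ => id) fun _ => Or.inl
      change i ∈ insert k (insert (S.num + 1) todo) ∪ completed ↔
        i = S.num + 1 ∨ i ∈ insert k (todo ∪ completed)
      simp only [Finset.mem_insert, Finset.mem_union]
      tauto
    | reductionEnd completed hc =>
      rw [hc] at h
      refine .iteration L f hfs (fun he => nomatch he) ?_ fun _ _ _ he => nomatch he
      refine h.of_eq rfl rfl rfl rfl rfl rfl rfl rfl rfl (fun k => ?_) (fun _ => id) fun _ => Or.inl
      change k ∈ completed ↔ k ∈ ∅ ∪ completed
      rw [Finset.empty_union]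
    | collect reduced k hc hk =>
      rw [hc] at h
      refine .iteration L f hfs (fun he => nomatch he) ?_ fun _ _ _ he => nomatch he
      refine h.collect hk (fun j => ?_) fun c => ?_
      · exact Finset.mem_erase.trans and_comm
      · change (c ∈ S.pairs ∨ c ∈ _) ∨ False ↔ (c ∈ S.pairs ∨ False) ∨ c ∈ _
        simp only [or_false]
    | collectEnd hc =>
      rw [hc] at h
      refine .iteration L f hfs (fun he => nomatch he) ?_ fun _ _ _ he => nomatch he
      exact h.of_eq rfl rfl rfl rfl rfl rfl rfl rfl rfl (fun _ => Iff.rfl) (fun _ => id)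
        fun _ => Or.inl
    | one hc hp h1 => exact .done rfl h.zero hne
    | setup P B hc hp h1 hP hnd hB =>
      rw [hc, hp] at h
      have h' : IterInv m (Ideal.span {p | p ∈ L}) f S ∅ ∅ := by
        simpa [Ctrl.active, Ctrl.selected] using h
      have hgb : IsGroebnerList m (Ideal.span {p | p ∈ L ++ [f]}) B := by
        refine hB.isGroebnerList ⟨fun p hpP => ?_, fun g hg hg0 => ?_⟩
        · obtain ⟨k, hk, rfl⟩ := (hP p).mp hpP
          rw [mem_span_append_singleton]
          rcases le_or_gt S.idx k with hidx | hidx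
          · obtain ⟨a, -, -, ha⟩ := h.lab' hidx (h.le_num hk)
            exact ⟨a, ha⟩
          · exact ⟨0, by simpa using h.prevInv.mem k (h.mem_prev_of_lt hk hidx)⟩
        · obtain ⟨a, ha⟩ := mem_span_append_singleton.mp hg
          obtain ⟨k, hk, hd⟩ := h'.groebner hnz ha hg0
          have hk' := (h.mem_curr_or k).mp (Or.inl hk)
          exact ⟨_, (hP _).mpr ⟨k, hk, rfl⟩, hne k hk'.1 hk'.2, hd⟩
      refine .main (L ++ [f]) ?_ rfl (PrevInv.setup S hgb hB.2.1) (fun j => Finset.mem_Icc) h.zero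
      rw [hfs, List.append_assoc]
      rfl

theorem Inv.conclusion {fs : List (MvPolynomial (Fin n) K)}
    (hnzd : ∀ L f rest, fs = L ++ f :: rest → ∀ h, h * f ∈ Ideal.span {p | p ∈ L} →
      h ∈ Ideal.span {p | p ∈ L}) (hS : Inv m fs S) :
    S.zeroReductions = 0 ∧ ∀ j, 1 ≤ j → j ≤ S.num → S.poly j ≠ 0 := by
  cases hS with
  | main L hfs hc h hprev hzero =>
    exact ⟨hzero, fun j h1 h2 => h.ne_zero j ((hprev j).mpr ⟨h1, h2⟩)⟩
  | iteration L f hfs hc h hirr =>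
    exact ⟨h.zero, fun j => h.poly_ne_zero (hnzd L f S.rest hfs)⟩
  | done hc hzero hpoly => exact ⟨hzero, hpoly⟩

end Runs

end F5C

/-- If all syzygies of the homogeneous input `F` are principal, then F5C reduces no polynomial to
zero: in no state of any run has `Top_Reduction` reported a reduction to zero, and the polynomials
computed so far (S-polynomials, normal forms, results of top-reductions), all of which are stored
in the list `r` of labeled polynomials, are nonzero. -/
theorem mainTheorem4 {n : ℕ} {K : Type*} [Field K] (m : MonomialOrder (Fin n)) {k : ℕ}
    (F : Fin k → MvPolynomial (Fin n) K) (hF0 : ∀ i, F i ≠ 0)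
    (hhom : ∀ i, ∃ d, (F i).IsHomogeneous d) (hsyz : SyzygiesArePrincipal F)
    (S : F5C.State n K) (hS : F5C.Reaches m F S) :
    S.zeroReductions = 0 ∧ ∀ j, 1 ≤ j → j ≤ S.num → S.poly j ≠ 0 := by
  obtain ⟨f, rest, hperm, hsort, hrun⟩ := hS
  have hne : ∀ g ∈ f :: rest, g ≠ 0 := fun g hg => by
    obtain ⟨i, rfl⟩ := List.mem_ofFn.mp (hperm.mem_iff.mp hg)
    exact hF0 i
  have hnzd : ∀ L g rest', f :: rest = L ++ g :: rest' → ∀ h, h * g ∈ Ideal.span {p | p ∈ L} →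
      h ∈ Ideal.span {p | p ∈ L} := fun L g rest' he h hh =>
    F5C.mem_span_of_mul_mem hF0 hhom hsyz (he ▸ hperm) (he ▸ hsort) hh
  have hinv : F5C.Inv m (f :: rest) S := by
    induction hrun with
    | refl =>
      exact .main [f] rfl rfl (F5C.PrevInv.init f (hne f (by simp)) rest)
        (fun j => Finset.mem_singleton.trans ⟨fun h => ⟨h.ge, h.le⟩, fun h => h.2.antisymm h.1⟩) rfl
    | tail _ hstep ih => exact ih.step hne hnzd hstep
  exact hinv.conclusion hnzd
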